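/- **Setting.** A planar network has $N_a$ agents $\mathcal N_a$ with true positions $p_1,\dots,p_{N_a}\in\mathbb R^2$ and $N_b$ anchors $\mathcal N_b$ with known positions; $p_j=[x_j\ y_j]^T$. For $(k,j)$ in a set of links (agent $k$ hears node $j\neq k$, and $p_k\ne p_j$), agent $k$ observes $$r_{kj}(t)=\sum_{l=1}^{L_{kj}}\alpha_{kj}^{(l)}\,s\big(t-\tau_{kj}^{(l)}\big)+z_{kj}(t),\quad t\in[0,T),\qquad \tau_{kj}^{(l)}=\tfrac1c\big(d_{kj}+b_{kj}^{(l)}\big),\quad d_{kj}=\|p_k-p_j\|,$$ where $s$ is known and three times continuously differentiable, $c>0$, and the $z_{kj}$ are independent white Gaussian noises of two-sided spectral density $N_0/2$ with $N_0>0$ (i.e. $\sqrt{N_0/2}$ times the derivatives of independent Brownian motions). The likelihood of $r_{kj}$ is $$f(r_{kj}|\theta)\propto\exp\Big\{\tfrac2{N_0}\int_0^{T}r_{kj}\mu_{kj}\,dt-\tfrac1{N_0}\int_0^{T}\mu_{kj}^2\,dt\Big\},\qquad \mu_{kj}(t)=\sum_l\alpha_{kj}^{(l)}s\big(t-\tau_{kj}^{(l)}\big).$$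 The channel vector $\kappa_{kj}$ collects the biases $b_{kj}^{(l)}$ and the amplitudes $\alpha_{kj}^{(l)}$. Each of its components is either a deterministic unknown or random; the random ones have, given the positions, a joint density $f(\kappa_{kj}|d_{kj})$ that depends on the positions only through $d_{kj}$ and does not involve the deterministic components. Channel vectors of different waveforms are independent. No a priori knowledge of the agents' positions $P=(p_1,\dots,p_{N_a})$ is available, so with $\kappa=(\kappa_{kj})$ and $\theta=(P,\kappa)$ the joint density is $f(r,\kappa|P)=\prod_{(k,j)}f(r_{kj}|\theta)f(\kappa_{kj}|d_{kj})$. The Fisher information matrix is $$J_\theta=\mathbb E_{r,\kappa}\Big\{-\frac{\partial^2\ln f(r,\kappa|P)}{\partial\theta\,\partial\theta^T}\Big\}=\begin{pmatrix}A&B\\B^T&D\end{pmatrix},$$ partitioned according to $\theta=(P,\kappa)$ (the expectation is not taken over deterministic components), and the equivalent Fisher information matrix (EFIM) for $P$ is $J_e(P)=A-BD^{-1}B^T$. **Regularity.** $D$ is invertible. The first and second derivatives of $\ln f(r_{kj}|\cdot)$ with respect to delays and amplitudes, and the second derivatives of $\ln f(\kappa_{kj}|d)$ with respect to $(d,\kappa_{kj})$,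 have finite expectations. For almost every value of the random channel components, $f(\kappa_{kj}|d)$ is $C^2$ in $(d,\kappa_{kj})$ near the given point, and it is Lipschitz in $d$ on a fixed neighbourhood of the true distance with a Lipschitz constant integrable over the random components. **Notation.** $\phi_{kj}$ is the polar angle of $p_k-p_j$, $q=[\cos\phi\ \sin\phi]^T$, and $$R(\phi)=q\,q^T=\begin{pmatrix}\cos^2\phi&\cos\phi\sin\phi\\\cos\phi\sin\phi&\sin^2\phi\end{pmatrix}.$$ Let $\tilde\kappa_{kj}$ collect the delays $\tau_{kj}^{(l)}$ and the scaled amplitudes $\alpha_{kj}^{(l)}/c$, let $l_{kj}$ be the vector with entries $1$ at the delays and $0$ at the amplitudes, and let $$\Psi_{kj}=\mathbb E_{r,\kappa}\Big\{-\frac{\partial^2\ln f(r_{kj}|\theta)}{\partial\tilde\kappa_{kj}\partial\tilde\kappa_{kj}^T}\Big\},\qquad \Xi_{kj}(x,y)=\mathbb E_\kappa\Big\{-\frac{\partial^2\ln f(\kappa_{kj}|d_{kj})}{\partial x\,\partial y^T}\Big\}.$$ For every link put $$\lambda_{kj}=\frac1{c^2}\Big[l_{kj}^T\Psi_{kj}l_{kj}+c^2\Xi_{kj}(d_{kj},d_{kj})-v_{kj}\big(\Psi_{kj}+c^2\Xi_{kj}(\kappa_{kj},\kappa_{kj})\big)^{-1}v_{kj}^T\Big],\qquad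 v_{kj}=l_{kj}^T\Psi_{kj}+c^2\Xi_{kj}(d_{kj},\kappa_{kj}),$$ and $\lambda_{kj}=0$ if $(k,j)$ is not a link. **Theorem 1.** The EFIM $J_e(P)$ is the $2N_a\times2N_a$ matrix whose $2\times2$ blocks are $$[J_e(P)]_{kk}=J_A(p_k)+\sum_{j\in\mathcal N_a\setminus\{k\}}C_{kj},\qquad [J_e(P)]_{kj}=-C_{kj}\quad(k\ne j),$$ where $$J_A(p_k)=\sum_{j\in\mathcal N_b}\lambda_{kj}R(\phi_{kj}),\qquad C_{kj}=C_{jk}=(\lambda_{kj}+\lambda_{jk})R(\phi_{kj}).$$ Moreover all $\lambda_{kj}$ are nonnegative if each density $f(\kappa_{kj}|d)$ is $C^2$ on $d>0$ and all values of its random components, with first and second partial derivatives at the true distance integrable over these components, and with $|\partial_d^2f|$ bounded, for $d$ near the true distance and almost every value of these components, by a fixed integrable function of them. -/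

import Mathlib

open MeasureTheory ProbabilityTheory
open scoped NNReal ENNReal Matrix

noncomputable section

namespace CoopLoc

/-! ### Calculus and waveform preliminaries -/

/-- The second partial derivative `∂² f / ∂u ∂v` at `x`, along the directions `u` and `v`. -/
def secondPartial {E : Type*} [NormedAddCommGroup E] [NormedSpace ℝ E]
    (f : E → ℝ) (x u v : E) : ℝ :=
  lineDeriv ℝ (fun y => lineDeriv ℝ f y v) x u

/-- Coordinate directions of the space of pairs (distance, vector): `none` is the distance
coordinate, `some i` is the `i`-th vector coordinate. -/
def pairDir {ι : Type*} [DecidableEq ι] : Option ι → ℝ × (ι → ℝ)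
  | none => (1, 0)
  | some i => (0, Pi.single i 1)

/-- The ranging direction matrix. -/
def rdm (φ : ℝ) : Matrix (Fin 2) (Fin 2) ℝ :=
  !![Real.cos φ ^ 2, Real.cos φ * Real.sin φ;
     Real.cos φ * Real.sin φ, Real.sin φ ^ 2]

/-- Channel coordinates of a waveform with `L` paths: `Sum.inl l` is the range bias (or the delay)
of path `l`, `Sum.inr l` is its amplitude. -/
abbrev Chan (L : ℕ) : Type := Fin L ⊕ Fin L

/-- The noise-free received waveform at time `t`, as a function of the delays `η (inl l)` and of
the scaled amplitudes `η (inr l)` (amplitude divided by `c`). -/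
def signal (s : ℝ → ℝ) (c : ℝ) {L : ℕ} (η : Chan L → ℝ) (t : ℝ) : ℝ :=
  ∑ l, c * η (Sum.inr l) * s (t - η (Sum.inl l))

/-- The delays `(d + b_l) / c` and the scaled amplitudes `α_l / c` of a channel `κ` at
distance `d`. -/
def delayAmp (c d : ℝ) {L : ℕ} (κ : Chan L → ℝ) : Chan L → ℝ :=
  Sum.elim (fun l => (d + κ (Sum.inl l)) / c) (fun l => κ (Sum.inr l) / c)

/-- The vector `[1 0 1 0 ⋯ 1 0]ᵀ`: ones at the delays, zeros at the amplitudes. -/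
def delayVec {L : ℕ} : Chan L → ℝ := Sum.elim (fun _ => 1) (fun _ => 0)

/-- `∫₀ᵀ r(t) g(t) dt` for the waveform `r = dX/dt`, given by its integrated path `X` with
`X 0 = 0`, and a continuously differentiable `g` (Paley–Wiener integral, i.e. the integral
defined by integration by parts; white noise is the derivative of Brownian motion). -/
def obsIntegral (T : ℝ) (X g : ℝ → ℝ) : ℝ :=
  g T * X T - ∫ t in (0 : ℝ)..T, X t * deriv g t

/-- The likelihood of a waveform observed on `[0, T)` in white Gaussian noise of two-sided power
spectral density `N₀ / 2`, relative to noise only, at delays and scaled amplitudes `η`. -/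
def waveLik (s : ℝ → ℝ) (c N₀ T : ℝ) {L : ℕ} (X : ℝ → ℝ) (η : Chan L → ℝ) : ℝ :=
  Real.exp (2 / N₀ * obsIntegral T X (signal s c η)
    - 1 / N₀ * ∫ t in (0 : ℝ)..T, (signal s c η t) ^ 2)

/-! ### The network -/

/-- A network of `Na` agents and `Nb` anchors in the plane. Nodes are elements of
`Fin Na ⊕ Fin Nb` (agents on the left, anchors on the right). -/
structure Network (Na Nb : ℕ) where
  /-- the true positions of the agents -/
  agentPos : Fin Na → EuclideanSpace ℝ (Fin 2)
  /-- the known positions of the anchors -/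
  anchorPos : Fin Nb → EuclideanSpace ℝ (Fin 2)
  /-- `(k, j)` is a link when agent `k` receives a waveform from node `j` -/
  links : Finset (Fin Na × (Fin Na ⊕ Fin Nb))
  /-- the transmitted waveform -/
  s : ℝ → ℝ
  /-- the propagation speed -/
  c : ℝ
  /-- twice the two-sided power spectral density of the noise -/
  N₀ : ℝ
  /-- the length of the observation interval -/
  T : ℝ
  /-- the number of multipath components of each received waveform -/
  paths : {w // w ∈ links} → ℕ
  /-- the channel parameters that are random (known a priori through their distribution);
  the other ones are deterministic unknowns -/
  random : ∀ w, Finset (Chan (paths w))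
  /-- `prior w x` is the density of the random channel parameters of link `w`, given that its end
  nodes are at distance `x` -/
  prior : ∀ w, ℝ → ({i // i ∈ random w} → ℝ) → ℝ
  /-- the true values of the deterministic channel parameters (other entries are not used) -/
  chanTrue : ∀ w, Chan (paths w) → ℝ
  no_self : ∀ k, (k, Sum.inl k) ∉ links
  separated : ∀ w ∈ links, agentPos w.1 ≠ Sum.elim agentPos anchorPos w.2
  c_pos : 0 < c
  N₀_pos : 0 < N₀
  T_pos : 0 < T
  prior_nonneg : ∀ w x, 0 < x → ∀ κ, 0 ≤ prior w x κ
  prior_integrable : ∀ w x, 0 < x → Integrable (prior w x)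
  prior_integral : ∀ w x, 0 < x → ∫ κ, prior w x κ = 1

namespace Network

variable {Na Nb : ℕ} (N : Network Na Nb)

/-- The received waveforms. -/
abbrev Link : Type := {w // w ∈ N.links}

/-- The indices of the parameter vector `θ`: coordinates of the agents' positions, then the channel
parameters of all received waveforms. -/
abbrev Param : Type := (Fin Na × Fin 2) ⊕ (Σ w : N.Link, Chan (N.paths w))

/-- The position of a node when the agents are at `P`. -/
def pos (P : Fin Na → EuclideanSpace ℝ (Fin 2)) (j : Fin Na ⊕ Fin Nb) :
    EuclideanSpace ℝ (Fin 2) :=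
  Sum.elim P N.anchorPos j

/-- The distance between the end nodes of a link when the agents are at `P`. -/
def linkDist (P : Fin Na → EuclideanSpace ℝ (Fin 2)) (w : N.Link) : ℝ :=
  dist (P w.1.1) (N.pos P w.1.2)

/-- The true distance between the end nodes of a link. -/
def trueDist (w : N.Link) : ℝ := N.linkDist N.agentPos w

/-- The angle `φ_{kj}`: the polar angle of `p_k - p_j`. -/
def angle (k : Fin Na) (j : Fin Na ⊕ Fin Nb) : ℝ :=
  Complex.arg ⟨N.agentPos k 0 - N.pos N.agentPos j 0, N.agentPos k 1 - N.pos N.agentPos j 1⟩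

/-- The prior density of the channel parameters of a link at distance `x`, as a function of the
whole channel vector; the deterministic parameters do not enter. -/
def chanDensity (w : N.Link) (x : ℝ) (κ : Chan (N.paths w) → ℝ) : ℝ :=
  N.prior w x (fun i => κ i)

/-- The law of the channel vector of a link at the true distance: the deterministic parameters have
their true values, the random ones have their prior density. -/
def chanLaw (w : N.Link) : Measure (Chan (N.paths w) → ℝ) :=
  (volume.withDensity fun κ : {i // i ∈ N.random w} → ℝ =>
      ENNReal.ofReal (N.prior w (N.trueDist w) κ)).map
    fun κ i => if h : i ∈ N.random w then κ ⟨i, h⟩ else N.chanTrue w i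

/-- The space of all channel vectors. -/
abbrev Channels : Type := ∀ w : N.Link, Chan (N.paths w) → ℝ

/-- The true parameter vector, when the channels are `κ`. -/
def trueParam (κ : N.Channels) : N.Param → ℝ :=
  Sum.elim (fun a => N.agentPos a.1 a.2) (fun i => κ i.1 i.2)

/-- The agents' positions encoded in a parameter vector. -/
def paramPos (θ : N.Param → ℝ) (k : Fin Na) : EuclideanSpace ℝ (Fin 2) :=
  !₂[θ (Sum.inl (k, 0)), θ (Sum.inl (k, 1))]

/-- The channel vector of a link encoded in a parameter vector. -/
def paramChan (θ : N.Param → ℝ) (w : N.Link) : Chan (N.paths w) → ℝ :=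
  fun i => θ (Sum.inr ⟨w, i⟩)

/-- The joint density `f(r, κ | P)` of the received waveforms (given by their integrated
paths `X`) and the channel parameters, as a function of the parameter vector. -/
def jointDensity (X : N.Link → ℝ → ℝ) (θ : N.Param → ℝ) : ℝ :=
  ∏ w : N.Link,
    (waveLik N.s N.c N.N₀ N.T (X w)
        (delayAmp N.c (N.linkDist (N.paramPos θ) w) (N.paramChan θ w)) *
      N.chanDensity w (N.linkDist (N.paramPos θ) w) (N.paramChan θ w))

section Observation

variable {Ω : Type*} [MeasurableSpace Ω] (Pr : Measure Ω) (B : N.Link → ℝ≥0 → Ω → ℝ)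

/-- The observation noises of the received waveforms are independent white Gaussian noises: their
integrated paths, normalized to unit intensity, are independent Brownian motions. -/
structure IsNoise : Prop where
  brownian : ∀ w, IsBrownianReal (B w) Pr
  indep : iIndepFun (fun w ω t => B w t ω) Pr

/-- The joint law of all the channel vectors, which are mutually independent, and of the noise. -/
def jointLaw : Measure (N.Channels × Ω) := (Measure.pi N.chanLaw).prod Pr

/-- The integrated path of the received waveform of link `w`, in the state `z` of channels and
noise: `X(t) = ∫₀ᵗ r(u) du`. -/
def obs (z : N.Channels × Ω) (w : N.Link) (t : ℝ) : ℝ :=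
  (∫ u in (0 : ℝ)..t, signal N.s N.c (delayAmp N.c (N.trueDist w) (z.1 w)) u)
    + Real.sqrt (N.N₀ / 2) * B w t.toNNReal z.2

/-- The Fisher information matrix `E {- ∂² ln f(r, κ | P) / ∂θ ∂θᵀ}`. -/
def fim : Matrix N.Param N.Param ℝ := Matrix.of fun i j =>
  ∫ z, -secondPartial (fun θ => Real.log (N.jointDensity (N.obs B z) θ)) (N.trueParam z.1)
    (Pi.single i 1) (Pi.single j 1) ∂(N.jointLaw Pr)

/-- The equivalent Fisher information matrix `A - B C⁻¹ Bᵀ` for the agents' positions. -/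
def efim : Matrix (Fin Na × Fin 2) (Fin Na × Fin 2) ℝ :=
  (N.fim Pr B).toBlocks₁₁ -
    (N.fim Pr B).toBlocks₁₂ * ((N.fim Pr B).toBlocks₂₂)⁻¹ * ((N.fim Pr B).toBlocks₁₂)ᵀ

/-- The log-likelihood of the received waveform of a link, in the state `z`, as a function of its
delays and scaled amplitudes. -/
def linkLogLik (z : N.Channels × Ω) (w : N.Link) (η : Chan (N.paths w) → ℝ) : ℝ :=
  Real.log (waveLik N.s N.c N.N₀ N.T (N.obs B z w) η)

/-- The true delays and scaled amplitudes of a link. -/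
def trueDelayAmp (κ : N.Channels) (w : N.Link) : Chan (N.paths w) → ℝ :=
  delayAmp N.c (N.trueDist w) (κ w)

/-- `Ψ_{kj}`: Fisher information of a waveform about its delays and scaled amplitudes. -/
def Psi (w : N.Link) : Matrix (Chan (N.paths w)) (Chan (N.paths w)) ℝ := Matrix.of fun i j =>
  ∫ z, -secondPartial (N.linkLogLik B z w) (N.trueDelayAmp z.1 w)
    (Pi.single i 1) (Pi.single j 1) ∂(N.jointLaw Pr)

/-- The logarithm of the prior channel density of a link, as a function of distance and channel. -/
def logPrior (w : N.Link) (y : ℝ × (Chan (N.paths w) → ℝ)) : ℝ :=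
  Real.log (N.chanDensity w y.1 y.2)

/-- `Ξ_{kj}`: a priori information of a channel about the distance (index `none`) and about the
channel parameters (indices `some i`). -/
def Xi (w : N.Link) : Matrix (Option (Chan (N.paths w))) (Option (Chan (N.paths w))) ℝ :=
  Matrix.of fun i j =>
    ∫ κ, -secondPartial (N.logPrior w) (N.trueDist w, κ) (pairDir i) (pairDir j) ∂(N.chanLaw w)

/-- The row vector `lᵀ Ψ + c² Ξ(d, κ)`. -/
def crossInfo (w : N.Link) : Chan (N.paths w) → ℝ :=
  delayVec ᵥ* N.Psi Pr B w + N.c ^ 2 • fun i => N.Xi w none (some i)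

/-- The matrix `Ψ + c² Ξ(κ, κ)`. -/
def chanInfo (w : N.Link) : Matrix (Chan (N.paths w)) (Chan (N.paths w)) ℝ :=
  N.Psi Pr B w + N.c ^ 2 • (N.Xi w).submatrix some some

/-- The ranging information intensity of a received waveform. -/
def linkRII (w : N.Link) : ℝ :=
  1 / N.c ^ 2 *
    (delayVec ⬝ᵥ (N.Psi Pr B w *ᵥ delayVec) + N.c ^ 2 * N.Xi w none none
      - N.crossInfo Pr B w ⬝ᵥ ((N.chanInfo Pr B w)⁻¹ *ᵥ N.crossInfo Pr B w))

/-- `λ_{kj}`, which is zero when agent `k` receives no waveform from node `j`. -/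
def rii (k : Fin Na) (j : Fin Na ⊕ Fin Nb) : ℝ :=
  if h : (k, j) ∈ N.links then N.linkRII Pr B ⟨(k, j), h⟩ else 0

/-- `J_A(p_k)`: the localization information of agent `k` from the anchors. -/
def anchorInfo (k : Fin Na) : Matrix (Fin 2) (Fin 2) ℝ :=
  ∑ j : Fin Nb, N.rii Pr B k (Sum.inr j) • rdm (N.angle k (Sum.inr j))

/-- `C_{kj}`: the localization information from the cooperation of agents `k` and `j`. -/
def coopInfo (k j : Fin Na) : Matrix (Fin 2) (Fin 2) ℝ :=
  (N.rii Pr B k (Sum.inl j) + N.rii Pr B j (Sum.inl k)) • rdm (N.angle k (Sum.inl j))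

/-- The block matrix with diagonal blocks `J_A(p_k) + ∑_{j ≠ k} C_{kj}` and off-diagonal
blocks `-C_{km}`. -/
def coopMatrix : Matrix (Fin Na × Fin 2) (Fin Na × Fin 2) ℝ := Matrix.of fun a b =>
  if a.1 = b.1 then
    (N.anchorInfo Pr B a.1 + ∑ j ∈ Finset.univ.erase a.1, N.coopInfo Pr B a.1 j) a.2 b.2
  else (-N.coopInfo Pr B a.1 b.1) a.2 b.2

/-- The expectations in the Fisher information exist: the first and second derivatives of the
log-likelihoods and the second derivatives of the log-priors have finite expectation. -/
structure FiniteInfo : Prop where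
  score : ∀ w i, Integrable (fun z => lineDeriv ℝ (N.linkLogLik B z w) (N.trueDelayAmp z.1 w)
    (Pi.single i 1)) (N.jointLaw Pr)
  lik : ∀ w i j, Integrable (fun z => secondPartial (N.linkLogLik B z w) (N.trueDelayAmp z.1 w)
    (Pi.single i 1) (Pi.single j 1)) (N.jointLaw Pr)
  prior : ∀ w i j, Integrable (fun κ => secondPartial (N.logPrior w) (N.trueDist w, κ)
    (pairDir i) (pairDir j)) (N.chanLaw w)

end Observation

/-- Regularity of the prior of a link near the true distance: almost everywhere it is twice
continuously differentiable, and it is Lipschitz in the distance with an integrable constant. -/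
structure PriorRegular (w : N.Link) : Prop where
  contDiffAt : ∀ᵐ κ : {i // i ∈ N.random w} → ℝ,
    ContDiffAt ℝ 2 (Function.uncurry (N.prior w)) (N.trueDist w, κ)
  lipschitz : ∃ ε > 0, ∃ b : ({i // i ∈ N.random w} → ℝ) → ℝ≥0, Integrable (fun κ => (b κ : ℝ)) ∧
    ∀ᵐ κ, LipschitzOnWith (b κ) (fun x => N.prior w x κ) (Metric.ball (N.trueDist w) ε)

/-- Smoothness of the prior of a link: it is twice continuously differentiable everywhere, its
first and second derivatives are integrable, and the second derivative in the distance is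
dominated near the true distance. -/
structure PriorSmooth (w : N.Link) : Prop where
  contDiffOn : ContDiffOn ℝ 2 (Function.uncurry (N.prior w)) (Set.Ioi 0 ×ˢ Set.univ)
  first : ∀ i, Integrable fun κ : {i // i ∈ N.random w} → ℝ =>
    lineDeriv ℝ (Function.uncurry (N.prior w)) (N.trueDist w, κ) (pairDir i)
  second : ∀ i j, Integrable fun κ : {i // i ∈ N.random w} → ℝ =>
    secondPartial (Function.uncurry (N.prior w)) (N.trueDist w, κ) (pairDir i) (pairDir j)
  dominated : ∃ ε > 0, ∃ b : ({i // i ∈ N.random w} → ℝ) → ℝ, Integrable b ∧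
    ∀ᵐ κ, ∀ x ∈ Metric.ball (N.trueDist w) ε,
      |iteratedDeriv 2 (fun x => N.prior w x κ) x| ≤ b κ

end Network

end CoopLoc

end

/-! The log-density splits into a sum over links, and the term of a link depends on the parameters
only through the distance `d` of its end nodes and its channel vector. By the second order chain
rule, the Hessian of such a term is its Hessian in (distance, channel) pulled back along the
differential of the pair, plus the derivative in `d` times the Hessian of the distance. The second
part averages to zero. The score of the waveform is a linear Paley–Wiener functional of a Brownian
path, hence centered (`IsBrownianReal.integrable_functional`). The score of the prior in `d` is
centered because the total mass of the prior is 1 at every positive distance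
(`integral_prior_score`). So the Fisher matrix is a sum over links of pulled back bilinear forms
`linkInfo` (`fim_apply`).

Each channel parameter belongs to a single link, so the channel block is block diagonal; and
positions act on a link only through `d`, so each link has a rank-one cross block. The Schur
complement is therefore the sum over links of `λ ∇d ∇dᵀ` (`efim_apply`). Since `∇d` is the unit
vector `q` at the receiving agent and `-q` at a transmitting agent, every term puts `R` on diagonal
blocks and `-R` on off-diagonal ones; collecting the ordered pairs of nodes gives the cooperative
form (`sum_links_eq_coopMatrix`).

For the sign, `λ` is the value of the quadratic form `linkInfo` at one vector
(`linkRII_eq_linkInfo`). The form is nonnegative because `Ψ` averages Gram integrals of signal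
derivatives (`Psi_nonneg`), and because `f · (-D² log f) = -D² f + (D f)² / f` where `∫ D² f = 0`
(`Xi_nonneg`): along the distance by differentiating the total mass twice, along the channel by
integration by parts. -/

namespace CoopLoc

open Filter Topology

/-! ### Second directional derivatives. -/

section Calculus

variable {E F : Type*} [NormedAddCommGroup E] [NormedSpace ℝ E]
  [NormedAddCommGroup F] [NormedSpace ℝ F]

lemma lineDeriv_eventuallyEq_fderiv {f : E → ℝ} {x : E} (hf : ContDiffAt ℝ 1 f x) (v : E) :
    (fun y => lineDeriv ℝ f y v) =ᶠ[𝓝 x] fun y => fderiv ℝ f y v := by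
  filter_upwards [hf.eventually (by simp)] with y hy
  exact (hy.differentiableAt one_ne_zero).lineDeriv_eq_fderiv

lemma ContDiffAt.lineDeriv_right {f : E → ℝ} {x : E} {n : ℕ} (hf : ContDiffAt ℝ (n + 1 : ℕ) f x)
    (v : E) : ContDiffAt ℝ n (fun y => lineDeriv ℝ f y v) x := by
  have h1 : ContDiffAt ℝ n (fun y => fderiv ℝ f y v) x :=
    (hf.fderiv_right (m := n) (by norm_cast)).clm_apply contDiffAt_const
  refine h1.congr_of_eventuallyEq (lineDeriv_eventuallyEq_fderiv (hf.of_le ?_) v)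
  norm_cast; omega

lemma ContDiff.lineDeriv_right {f : E → ℝ} {n : ℕ} (hf : ContDiff ℝ (n + 1 : ℕ) f)
    (v : E) : ContDiff ℝ n (fun y => lineDeriv ℝ f y v) :=
  contDiff_iff_contDiffAt.2 fun _ => ContDiffAt.lineDeriv_right hf.contDiffAt v

/-- Iterated line derivatives make sense without any regularity, but bilinearity and symmetry in the
directions come only through the second Fréchet derivative. -/
lemma secondPartial_eq_fderiv {f : E → ℝ} {x : E} (hf : ContDiffAt ℝ 2 f x) (u v : E) :
    secondPartial f x u v = fderiv ℝ (fderiv ℝ f) x u v := by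
  have h1 := lineDeriv_eventuallyEq_fderiv (hf.of_le one_le_two) v
  rw [secondPartial, h1.lineDeriv_eq]
  have h2 : DifferentiableAt ℝ (fderiv ℝ f) x :=
    (hf.fderiv_right (m := 1) (by norm_num)).differentiableAt one_ne_zero
  have h3 := (h2.hasFDerivAt.clm_apply (hasFDerivAt_const v x))
  rw [h3.differentiableAt.lineDeriv_eq_fderiv, h3.fderiv]
  simp

lemma secondPartial_comm {f : E → ℝ} {x : E} (hf : ContDiffAt ℝ 2 f x) (u v : E) :
    secondPartial f x u v = secondPartial f x v u := by
  rw [secondPartial_eq_fderiv hf, secondPartial_eq_fderiv hf]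
  exact (hf.isSymmSndFDerivAt (by simp)).eq u v

lemma secondPartial_congr {f g : E → ℝ} {x : E} (h : f =ᶠ[𝓝 x] g) (u v : E) :
    secondPartial f x u v = secondPartial g x u v := by
  refine Filter.EventuallyEq.lineDeriv_eq ?_
  filter_upwards [eventually_eventually_nhds.2 h] with y hy
  exact Filter.EventuallyEq.lineDeriv_eq hy

lemma secondPartial_add {f g : E → ℝ} {x : E} (hf : ContDiffAt ℝ 2 f x)
    (hg : ContDiffAt ℝ 2 g x) (u v : E) :
    secondPartial (fun y => f y + g y) x u v = secondPartial f x u v + secondPartial g x u v := by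
  have h1 : (fun y => lineDeriv ℝ (fun y => f y + g y) y v) =ᶠ[𝓝 x]
      fun y => lineDeriv ℝ f y v + lineDeriv ℝ g y v := by
    filter_upwards [hf.eventually (by simp), hg.eventually (by simp)] with y hy hy'
    have a := hy.differentiableAt two_ne_zero
    have b := hy'.differentiableAt two_ne_zero
    rw [(a.fun_add b).lineDeriv_eq_fderiv, fderiv_fun_add a b, a.lineDeriv_eq_fderiv,
      b.lineDeriv_eq_fderiv]; rfl
  rw [secondPartial, h1.lineDeriv_eq]
  have a := (ContDiffAt.lineDeriv_right (n := 1) hf v).differentiableAt one_ne_zero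
  have b := (ContDiffAt.lineDeriv_right (n := 1) hg v).differentiableAt one_ne_zero
  rw [(a.fun_add b).lineDeriv_eq_fderiv, fderiv_fun_add a b, secondPartial, secondPartial,
    a.lineDeriv_eq_fderiv, b.lineDeriv_eq_fderiv]; rfl

lemma secondPartial_sum {ι : Type*} (s : Finset ι) {f : ι → E → ℝ} {x : E}
    (hf : ∀ i ∈ s, ContDiffAt ℝ 2 (f i) x) (u v : E) :
    secondPartial (fun y => ∑ i ∈ s, f i y) x u v = ∑ i ∈ s, secondPartial (f i) x u v := by
  classical
  induction s using Finset.induction_on with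
  | empty => simp [secondPartial, lineDeriv]
  | insert a s ha ih =>
    simp only [Finset.sum_insert ha]
    rw [secondPartial_add (hf a (by simp)) (ContDiffAt.sum fun i hi => hf i (by simp [hi])),
      ih fun i hi => hf i (by simp [hi])]

/-- Second order chain rule. -/
lemma secondPartial_comp {g : F → ℝ} {Φ : E → F} {x : E} (hg : ContDiffAt ℝ 2 g (Φ x))
    (hΦ : ContDiffAt ℝ 2 Φ x) (u v : E) :
    secondPartial (fun y => g (Φ y)) x u v =
      secondPartial g (Φ x) (fderiv ℝ Φ x u) (fderiv ℝ Φ x v) +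
        fderiv ℝ g (Φ x) (fderiv ℝ (fderiv ℝ Φ) x u v) := by
  have h1 : (fun y => lineDeriv ℝ (fun y => g (Φ y)) y v) =ᶠ[𝓝 x]
      fun y => fderiv ℝ g (Φ y) (fderiv ℝ Φ y v) := by
    filter_upwards [hΦ.eventually (by simp),
      hΦ.continuousAt.eventually (hg.eventually (by simp))] with y hy hy'
    have a := hy.differentiableAt two_ne_zero
    have b := hy'.differentiableAt two_ne_zero
    rw [(b.fun_comp' y a).lineDeriv_eq_fderiv, fderiv_fun_comp y b a]; rfl
  rw [secondPartial, h1.lineDeriv_eq]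
  have dg : DifferentiableAt ℝ (fderiv ℝ g) (Φ x) :=
    (hg.fderiv_right (m := 1) (by norm_num)).differentiableAt one_ne_zero
  have dΦ : DifferentiableAt ℝ (fderiv ℝ Φ) x :=
    (hΦ.fderiv_right (m := 1) (by norm_num)).differentiableAt one_ne_zero
  have h2 := (dg.hasFDerivAt.comp x (hΦ.differentiableAt two_ne_zero).hasFDerivAt).clm_apply
    (dΦ.hasFDerivAt.clm_apply (hasFDerivAt_const v x))
  have h3 := h2.hasLineDerivAt u
  refine h3.lineDeriv.trans ?_
  rw [secondPartial_eq_fderiv hg]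
  simp [add_comm]

lemma secondPartial_comp_clm {g : F → ℝ} (A : E →L[ℝ] F) {x : E} (hg : ContDiffAt ℝ 2 g (A x))
    (u v : E) :
    secondPartial (fun y => g (A y)) x u v = secondPartial g (A x) (A u) (A v) := by
  rw [secondPartial_comp hg A.contDiff.contDiffAt]
  have : fderiv ℝ (A : E → F) = fun _ => A := by ext1 y; exact A.fderiv
  simp [this]

lemma secondPartial_sum_sum {ι : Type*} [Fintype ι] {f : E → ℝ} {x : E}
    (hf : ContDiffAt ℝ 2 f x) (e : ι → E) (a b : ι → ℝ) :
    secondPartial f x (∑ i, a i • e i) (∑ j, b j • e j) =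
      ∑ i, ∑ j, a i * b j * secondPartial f x (e i) (e j) := by
  simp only [secondPartial_eq_fderiv hf, map_sum, map_smul, _root_.sum_apply,
    _root_.smul_apply, smul_eq_mul, Finset.mul_sum]
  rw [Finset.sum_comm]
  exact Finset.sum_congr rfl fun i _ => Finset.sum_congr rfl fun j _ => by ring

lemma pi_eq_sum_single {ι : Type*} [Fintype ι] [DecidableEq ι] (a : ι → ℝ) :
    a = ∑ i, a i • (Pi.single i 1 : ι → ℝ) := by
  ext j; simp [Finset.sum_apply, Pi.single_apply]

lemma pair_eq_sum_pairDir {ι : Type*} [Fintype ι] [DecidableEq ι] (y : ℝ × (ι → ℝ)) :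
    y = ∑ o : Option ι, (o.elim y.1 y.2) • pairDir o := by
  rw [Fintype.sum_option]
  ext j
  · simp [pairDir, Prod.fst_sum]
  · simp [pairDir, Prod.snd_sum, Finset.sum_apply, Pi.single_apply]

/-- At a point where a nonnegative function vanishes, its second derivatives are nonnegative. -/
lemma secondPartial_nonneg_of_eq_zero {f : E → ℝ} {x : E} (hf : ContDiffAt ℝ 2 f x)
    (h0 : f x = 0) (hn : ∀ᶠ y in 𝓝 x, 0 ≤ f y) (u : E) : 0 ≤ secondPartial f x u u := by
  set ℓ : ℝ → E := fun t => x + t • u with hℓ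
  have hℓ0 : ℓ 0 = x := by simp [hℓ]
  have hℓc : ContDiff ℝ 2 ℓ := by fun_prop
  have hd : ∀ t, fderiv ℝ ℓ t = (ContinuousLinearMap.id ℝ ℝ).smulRight u := by
    intro t
    exact (((ContinuousLinearMap.id ℝ ℝ).smulRight u).hasFDerivAt.const_add x).fderiv
  have hfl : ContDiffAt ℝ 2 f (ℓ 0) := by rwa [hℓ0]
  have hdd : fderiv ℝ (fderiv ℝ ℓ) 0 = 0 := by
    have : fderiv ℝ ℓ = fun _ => (ContinuousLinearMap.id ℝ ℝ).smulRight u := funext hd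
    rw [this]; simp
  have h1 : secondPartial f x u u = secondPartial (fun t => f (ℓ t)) 0 1 1 := by
    rw [secondPartial_comp hfl hℓc.contDiffAt, hℓ0, hd, hdd]; simp
  have h2 : secondPartial (fun t => f (ℓ t)) 0 1 1 = deriv (deriv fun t => f (ℓ t)) 0 := by
    simp only [secondPartial, lineDeriv]
    have : ∀ (g : ℝ → ℝ) (y : ℝ), deriv (fun t : ℝ => g (y + t • (1 : ℝ))) 0 = deriv g y := by
      intro g y
      simp only [smul_eq_mul, mul_one]
      rw [deriv_comp_const_add, add_zero]
    rw [this fun y => deriv (fun t => f (ℓ (y + t • (1 : ℝ)))) 0]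
    congr 1; ext y
    exact this (fun t => f (ℓ t)) y
  have hev : ∀ᶠ t in 𝓝 (0 : ℝ), 0 ≤ f (ℓ t) :=
    (hℓc.continuous.tendsto' 0 x hℓ0).eventually hn
  have hmin : IsLocalMin (fun t => f (ℓ t)) 0 := by
    filter_upwards [hev] with t ht
    simpa [hℓ0, h0] using ht
  rw [h1, h2]
  -- A negative second derivative at a critical point would make it a local maximum too, so the
  -- function would be locally constant along the line and its second derivative zero.
  by_contra! hneg
  have hmax := isLocalMax_of_deriv_deriv_neg hneg hmin.deriv_eq_zero
    (hfl.comp 0 hℓc.contDiffAt).continuousAt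
  have hc : (fun t => f (ℓ t)) =ᶠ[𝓝 0] fun _ => f (ℓ 0) := by
    filter_upwards [hmin, hmax] with t h h' using le_antisymm h' h
  have hz := hc.deriv.deriv_eq
  rw [hz] at hneg
  simp at hneg

end Calculus

/-! ### Differentiation under an integral over a bounded interval. -/

section Parametric

universe u

lemma continuous_intervalIntegral_mul {E : Type*} [TopologicalSpace E]
    [FirstCountableTopology E] {G : Type*} [NormedAddCommGroup G] [NormedSpace ℝ G]
    {Y : ℝ → ℝ} (hY : Continuous Y) {F : E → ℝ → G}
    (hF : Continuous (Function.uncurry F)) (a b : ℝ) :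
    Continuous fun η => ∫ t in a..b, Y t • F η t := by
  apply intervalIntegral.continuous_parametric_intervalIntegral_of_continuous'
  exact (hY.comp continuous_snd).smul hF

variable {E : Type*} [NormedAddCommGroup E] [NormedSpace ℝ E]

lemma hasFDerivAt_intervalIntegral_smul {G : Type*} [NormedAddCommGroup G] [NormedSpace ℝ G]
    [ProperSpace E]
    {Y : ℝ → ℝ} (hY : Continuous Y) {F : E → ℝ → G} {F' : E → ℝ → E →L[ℝ] G}
    (hF : Continuous (Function.uncurry F)) (hF' : Continuous (Function.uncurry F'))
    (hd : ∀ η t, HasFDerivAt (fun η => F η t) (F' η t) η) (a b : ℝ) (η : E) :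
    HasFDerivAt (fun η => ∫ t in a..b, Y t • F η t) (∫ t in a..b, Y t • F' η t) η := by
  have hcF : ∀ η, Continuous fun t => Y t • F η t := fun η =>
    hY.smul (hF.comp (Continuous.prodMk_right η))
  have hcF' : ∀ η, Continuous fun t => Y t • F' η t := fun η =>
    hY.smul (hF'.comp (Continuous.prodMk_right η))
  -- Closed balls are compact in a proper space, so continuity of the derivative already provides a
  -- constant dominating function.
  obtain ⟨C, hC⟩ := ((isCompact_closedBall η 1).prod
    (isCompact_uIcc (a := a) (b := b))).exists_bound_of_continuousOn
    (f := fun p : E × ℝ => Y p.2 • F' p.1 p.2)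
    ((hY.comp continuous_snd).smul hF').continuousOn
  refine intervalIntegral.hasFDerivAt_integral_of_dominated_of_fderiv_le
    (F' := fun η t => Y t • F' η t) (bound := fun _ => C)
    (Metric.closedBall_mem_nhds η one_pos) (Eventually.of_forall fun η =>
      (hcF η).aestronglyMeasurable) ((hcF η).intervalIntegrable _ _)
      (hcF' η).aestronglyMeasurable ?_ intervalIntegrable_const ?_
  · exact ae_of_all _ fun t ht x hx => hC (x, t) ⟨hx, Set.uIoc_subset_uIcc ht⟩
  · exact ae_of_all _ fun t ht x hx => (hd x t).const_smul (Y t)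

lemma hasFDerivAt_partial_left {G : Type*} [NormedAddCommGroup G] [NormedSpace ℝ G]
    {F : E → ℝ → G} (hF : Differentiable ℝ (Function.uncurry F)) (η : E) (t : ℝ) :
    HasFDerivAt (fun η => F η t)
      ((fderiv ℝ (Function.uncurry F) (η, t)).comp (ContinuousLinearMap.inl ℝ E ℝ)) η := by
  exact (hF (η, t)).hasFDerivAt.comp (f := fun η => (η, t)) η (hasFDerivAt_prodMk_left η t)

/-- Induction on `n` with the target `G` generalized, since the derivative takes values in `E →L[ℝ]
G`. The common universe of `E` and `G` keeps that space in the range of the induction hypothesis. -/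
lemma contDiff_intervalIntegral_smul {E : Type u} [NormedAddCommGroup E] [NormedSpace ℝ E]
    [ProperSpace E] {Y : ℝ → ℝ} (hY : Continuous Y) (a b : ℝ) (n : ℕ) :
    ∀ {G : Type u} [NormedAddCommGroup G] [NormedSpace ℝ G] {F : E → ℝ → G},
      ContDiff ℝ n (Function.uncurry F) → ContDiff ℝ n fun η => ∫ t in a..b, Y t • F η t := by
  induction n with
  | zero =>
    intro G _ _ F hF
    exact contDiff_zero.2 (continuous_intervalIntegral_mul hY hF.continuous a b)
  | succ n ih =>
    intro G _ _ F hF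
    have hF1 : Differentiable ℝ (Function.uncurry F) := hF.differentiable (by simp)
    let F' : E → ℝ → E →L[ℝ] G := fun η t =>
      (fderiv ℝ (Function.uncurry F) (η, t)).comp (ContinuousLinearMap.inl ℝ E ℝ)
    have hF' : ContDiff ℝ n (Function.uncurry F') := by
      have : ContDiff ℝ n (fderiv ℝ (Function.uncurry F)) := hF.fderiv_right (by norm_cast)
      exact this.clm_comp contDiff_const
    refine (contDiff_succ_iff_hasFDerivAt (n := n)).2 ⟨_, ih hF', fun η => ?_⟩
    exact hasFDerivAt_intervalIntegral_smul hY hF.continuous hF'.continuous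
      (fun η t => hasFDerivAt_partial_left hF1 η t) a b η

lemma lineDeriv_partial_left {F : E → ℝ → ℝ} (hF : Differentiable ℝ (Function.uncurry F))
    (η : E) (t : ℝ) (v : E) :
    lineDeriv ℝ (fun η => F η t) η v = lineDeriv ℝ (Function.uncurry F) (η, t) (v, 0) := by
  rw [((hasFDerivAt_partial_left hF η t).hasLineDerivAt v).lineDeriv,
    (hF (η, t)).lineDeriv_eq_fderiv]
  simp

lemma contDiff_uncurry_lineDeriv {F : E → ℝ → ℝ} {n : ℕ}
    (hF : ContDiff ℝ (n + 1 : ℕ) (Function.uncurry F)) (v : E) :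
    ContDiff ℝ n (Function.uncurry fun η t => lineDeriv ℝ (fun η => F η t) η v) := by
  have : (Function.uncurry fun η t => lineDeriv ℝ (fun η => F η t) η v) =
      fun p => lineDeriv ℝ (Function.uncurry F) p (v, 0) := by
    ext ⟨η, t⟩
    exact lineDeriv_partial_left (hF.differentiable (by simp)) η t v
  rw [this]
  exact ContDiff.lineDeriv_right hF _

lemma lineDeriv_intervalIntegral_mul [ProperSpace E] {Y : ℝ → ℝ} (hY : Continuous Y)
    {F : E → ℝ → ℝ} (hF : ContDiff ℝ 1 (Function.uncurry F)) (a b : ℝ) (η v : E) :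
    lineDeriv ℝ (fun η => ∫ t in a..b, Y t * F η t) η v =
      ∫ t in a..b, Y t * lineDeriv ℝ (fun η => F η t) η v := by
  have hF1 : Differentiable ℝ (Function.uncurry F) := hF.differentiable (by simp)
  have hc : Continuous (Function.uncurry fun η t =>
      (fderiv ℝ (Function.uncurry F) (η, t)).comp (ContinuousLinearMap.inl ℝ E ℝ)) :=
    (hF.continuous_fderiv one_ne_zero).clm_comp continuous_const
  have h := hasFDerivAt_intervalIntegral_smul hY hF.continuous hc
    (fun η t => hasFDerivAt_partial_left hF1 η t) a b η
  refine (h.hasLineDerivAt v).lineDeriv.trans ?_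
  rw [ContinuousLinearMap.intervalIntegral_apply]
  · refine intervalIntegral.integral_congr fun t _ => ?_
    simp only [_root_.smul_apply, smul_eq_mul]
    rw [((hasFDerivAt_partial_left hF1 η t).hasLineDerivAt v).lineDeriv]
  · exact (hY.smul (hc.comp (Continuous.prodMk_right η))).intervalIntegrable _ _

end Parametric

/-! ### Paley–Wiener functionals of Brownian motion. -/

section Brownian

variable {Ω : Type*} [MeasurableSpace Ω] {Pr : Measure Ω} {W : ℝ≥0 → Ω → ℝ}

/-- A Brownian motion is jointly almost everywhere measurable in time and state. -/
lemma IsBrownianReal.aestronglyMeasurable_uncurry [SFinite Pr] (hW : IsBrownianReal W Pr)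
    (μ : Measure ℝ) [SFinite μ] :
    AEStronglyMeasurable (fun p : ℝ × Ω => W p.1.toNNReal p.2) (μ.prod Pr) := by
  have hm : ∀ t, AEMeasurable (W t) Pr := hW.toIsPreBrownianReal.aemeasurable
  -- The path is approximated by its values at the grid times `⌊t (n + 1)⌋ / (n + 1)`. Only
  -- countably many times occur, so one null set suffices to replace all the values by measurable
  -- versions; continuity of the path gives the limit.
  let q : ℕ → ℕ → ℝ≥0 := fun n k => (k : ℝ≥0) / ((n : ℝ≥0) + 1)
  let V : ℕ → ℝ × Ω → ℝ := fun n p =>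
    (hm (q n ⌊(p.1.toNNReal : ℝ) * ((n : ℝ) + 1)⌋₊)).mk _ p.2
  refine aestronglyMeasurable_of_tendsto_ae atTop (f := V) (fun n => ?_) ?_
  · have h1 : Measurable fun p : ℕ × Ω => (hm (q n p.1)).mk _ p.2 :=
      measurable_from_prod_countable_right fun k => (hm (q n k)).measurable_mk
    have h2 : Measurable fun p : ℝ × Ω => (⌊(p.1.toNNReal : ℝ) * ((n : ℝ) + 1)⌋₊, p.2) := by
      refine Measurable.prodMk ?_ measurable_snd
      exact Nat.measurable_floor.comp
        ((measurable_real_toNNReal.comp measurable_fst).coe_nnreal_real.mul_const _)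
    exact (h1.comp h2).aestronglyMeasurable
  · have h : ∀ᵐ ω ∂Pr, Continuous (W · ω) ∧ ∀ n k, W (q n k) ω = (hm (q n k)).mk _ ω := by
      refine hW.cont.and (ae_all_iff.2 fun n => ae_all_iff.2 fun k => (hm _).ae_eq_mk)
    have h' : ∀ᵐ p ∂(μ.prod Pr), Continuous (W · p.2) ∧
        ∀ n k, W (q n k) p.2 = (hm (q n k)).mk _ p.2 :=
      Measure.quasiMeasurePreserving_snd.ae h
    filter_upwards [h'] with p ⟨hc, he⟩
    have h3 : Tendsto (fun n : ℕ => q n ⌊(p.1.toNNReal : ℝ) * ((n : ℝ) + 1)⌋₊) atTop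
        (𝓝 p.1.toNNReal) := by
      have h4 : Tendsto (fun n : ℕ => ((n : ℝ) + 1)) atTop atTop :=
        tendsto_atTop_add_const_right _ _ tendsto_natCast_atTop_atTop
      rw [← NNReal.tendsto_coe]
      simpa [q, Function.comp_def] using
        (tendsto_nat_floor_mul_div_atTop (R := ℝ) p.1.toNNReal.coe_nonneg).comp h4
    refine ((hc.tendsto _).comp h3).congr fun n => ?_
    exact he n _

/-- The Paley–Wiener functional of a Brownian motion is integrable and centered. -/
lemma IsBrownianReal.integrable_functional [IsProbabilityMeasure Pr]
    (hW : IsBrownianReal W Pr) (a : ℝ) {h : ℝ → ℝ} (hh : Continuous h) {T : ℝ} (hT : 0 ≤ T) :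
    Integrable (fun ω => a * W T.toNNReal ω - ∫ t in (0 : ℝ)..T, W t.toNNReal ω * h t) Pr ∧
    ∫ ω, (a * W T.toNNReal ω - ∫ t in (0 : ℝ)..T, W t.toNNReal ω * h t) ∂Pr = 0 := by
  have hP := hW.toIsPreBrownianReal
  set ν : Measure ℝ := volume.restrict (Set.Ioc 0 T)
  have hmeas : AEStronglyMeasurable (fun p : ℝ × Ω => W p.1.toNNReal p.2 * h p.1)
      (ν.prod Pr) :=
    (IsBrownianReal.aestronglyMeasurable_uncurry hW ν).mul
      (hh.measurable.comp measurable_fst).aestronglyMeasurable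
  -- From `|x| ≤ 1 + x²` and variance `t`. This linear bound gives the joint integrability that
  -- Fubini requires; the mean is then zero because each `W t` is centered.
  have hbound : ∀ t : ℝ≥0, ∫ ω, ‖W t ω‖ ∂Pr ≤ 1 + t := by
    intro t
    have hL2 : MemLp (W t) 2 Pr := (hP.isGaussianProcess.hasGaussianLaw_eval t).memLp_two
    have hsq : ∫ ω, (W t ω) ^ 2 ∂Pr = t := by
      have h1 := hP.covariance_eval t t
      rw [min_self, covariance_self (hP.aemeasurable t), variance_eq_integral (hP.aemeasurable t),
        hP.integral_eval] at h1
      simpa using h1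
    calc ∫ ω, ‖W t ω‖ ∂Pr ≤ ∫ ω, (1 + (W t ω) ^ 2) ∂Pr := by
          refine integral_mono (hP.integrable_eval t).norm
            ((integrable_const 1).add hL2.integrable_sq) fun ω => ?_
          change |W t ω| ≤ 1 + (W t ω) ^ 2
          rw [← sq_abs]
          nlinarith [sq_nonneg (|W t ω| - 1), abs_nonneg (W t ω)]
      _ = 1 + t := by
          rw [integral_add (integrable_const 1) hL2.integrable_sq, hsq]; simp
  have hint : Integrable (fun p : ℝ × Ω => W p.1.toNNReal p.2 * h p.1) (ν.prod Pr) := by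
    refine (integrable_prod_iff hmeas).2 ⟨ae_of_all _ fun t =>
      (hP.integrable_eval t.toNNReal).mul_const (h t), ?_⟩
    have hg : Integrable (fun t : ℝ => (1 + |t|) * |h t|) ν := by
      have : Continuous fun t : ℝ => (1 + |t|) * |h t| := by fun_prop
      exact (this.intervalIntegrable (μ := volume) 0 T).1
    refine hg.mono' hmeas.norm.integral_prod_right' (ae_of_all _ fun t => ?_)
    simp only [norm_mul]
    rw [integral_mul_const, Real.norm_of_nonneg (mul_nonneg
      (integral_nonneg fun ω => norm_nonneg _) (norm_nonneg _))]
    refine mul_le_mul_of_nonneg_right ((hbound _).trans ?_) (norm_nonneg _)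
    have : (t.toNNReal : ℝ) ≤ |t| := by
      rw [Real.coe_toNNReal']; exact max_le (le_abs_self _) (abs_nonneg _)
    linarith
  have hsw := hint.swap
  have i1 : Integrable (fun ω => ∫ t in (0 : ℝ)..T, W t.toNNReal ω * h t) Pr := by
    simp_rw [intervalIntegral.integral_of_le hT]
    exact hsw.integral_prod_left
  have e1 : ∫ ω, (∫ t in (0 : ℝ)..T, W t.toNNReal ω * h t) ∂Pr = 0 := by
    simp_rw [intervalIntegral.integral_of_le hT]
    have := integral_integral_swap (f := fun t ω => W t.toNNReal ω * h t) hint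
    rw [← this]
    simp [integral_mul_const, hP.integral_eval]
  have i2 := (hP.integrable_eval T.toNNReal).const_mul a
  refine ⟨i2.sub i1, ?_⟩
  rw [integral_sub i2 i1, e1, integral_const_mul, hP.integral_eval]
  simp

end Brownian

/-! ### Derivatives of the two functionals in the log-likelihood: squared residual and noise
functional. -/

section Functionals

variable {E : Type*} [NormedAddCommGroup E] [NormedSpace ℝ E]

lemma lineDeriv_const_mul (r : ℝ) (f : E → ℝ) (x v : E) :
    lineDeriv ℝ (fun y => r * f y) x v = r * lineDeriv ℝ f x v := by
  simp only [lineDeriv, deriv_const_mul_field']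

lemma secondPartial_const_mul (r : ℝ) (f : E → ℝ) (x u v : E) :
    secondPartial (fun y => r * f y) x u v = r * secondPartial f x u v := by
  simp only [secondPartial, lineDeriv_const_mul]

lemma secondPartial_const_add (r : ℝ) (f : E → ℝ) (x u v : E) :
    secondPartial (fun y => r + f y) x u v = secondPartial f x u v := by
  simp [secondPartial, lineDeriv]

variable [ProperSpace E] {F G : E → ℝ → ℝ}

lemma lineDeriv_integral_sq (hF : ContDiff ℝ 1 (Function.uncurry F)) {g : ℝ → ℝ}
    (hg : ContDiff ℝ 1 g) (a b : ℝ) (η v : E) :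
    lineDeriv ℝ (fun η => ∫ t in a..b, (F η t - g t) ^ 2) η v =
      ∫ t in a..b, 2 * (F η t - g t) * lineDeriv ℝ (fun η => F η t) η v := by
  have h1 : ContDiff ℝ 1 (Function.uncurry fun η t => (F η t - g t) ^ 2) :=
    (hF.sub (hg.comp contDiff_snd)).pow 2
  have h2 := lineDeriv_intervalIntegral_mul (Y := fun _ => 1) continuous_const h1 a b η v
  simp only [one_mul] at h2
  rw [h2]
  refine intervalIntegral.integral_congr fun t _ => ?_
  have h3 := hasFDerivAt_partial_left (hF.differentiable one_ne_zero) η t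
  have h4 := (h3.sub_const (g t)).pow 2
  rw [(h3.hasLineDerivAt v).lineDeriv]
  refine (h4.hasLineDerivAt v).lineDeriv.trans ?_
  simp

/-- Here `E : Type` because `contDiff_intervalIntegral_smul` wants parameter space and target, now
`ℝ`, in one universe. -/
lemma contDiff_integral_sq {E : Type} [NormedAddCommGroup E] [NormedSpace ℝ E] [ProperSpace E]
    {F : E → ℝ → ℝ} {n : ℕ} (hF : ContDiff ℝ n (Function.uncurry F))
    {g : ℝ → ℝ} (hg : ContDiff ℝ n g) (a b : ℝ) :
    ContDiff ℝ n fun η => ∫ t in a..b, (F η t - g t) ^ 2 := by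
  have h1 : ContDiff ℝ n (Function.uncurry fun η t => (F η t - g t) ^ 2) :=
    (hF.sub (hg.comp contDiff_snd)).pow 2
  simpa using contDiff_intervalIntegral_smul (Y := fun _ => 1) continuous_const a b n h1

/-- The residual vanishes at `η₀`, so the term with second derivatives of `F` drops out and only the
product of first derivatives survives. -/
lemma secondPartial_integral_sq (hF : ContDiff ℝ 2 (Function.uncurry F)) (a b : ℝ) (η₀ u v : E) :
    secondPartial (fun η => ∫ t in a..b, (F η t - F η₀ t) ^ 2) η₀ u v =
      2 * ∫ t in a..b, lineDeriv ℝ (fun η => F η t) η₀ u * lineDeriv ℝ (fun η => F η t) η₀ v := by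
  have hF1 := hF.of_le one_le_two
  have hg : ContDiff ℝ 1 (F η₀) := hF1.comp (contDiff_prodMk_right η₀)
  have hv := contDiff_uncurry_lineDeriv (n := 1) hF v
  have h0 : (fun η => lineDeriv ℝ (fun η => ∫ t in a..b, (F η t - F η₀ t) ^ 2) η v) =
      fun η => ∫ t in a..b, 2 * ((F η t - F η₀ t) * lineDeriv ℝ (fun η => F η t) η v) := by
    ext η
    rw [lineDeriv_integral_sq hF1 hg]
    simp only [mul_assoc]
  have h1 : ContDiff ℝ 1 (Function.uncurry fun η t =>
      (F η t - F η₀ t) * lineDeriv ℝ (fun η => F η t) η v) :=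
    (hF1.sub (hg.comp contDiff_snd)).mul hv
  rw [secondPartial, h0, lineDeriv_intervalIntegral_mul (Y := fun _ => 2) continuous_const h1,
    ← intervalIntegral.integral_const_mul]
  refine intervalIntegral.integral_congr fun t _ => ?_
  have h3 := hasFDerivAt_partial_left (hF1.differentiable one_ne_zero) η₀ t
  have h4 := hasFDerivAt_partial_left (hv.differentiable one_ne_zero) η₀ t
  have h5 := (h3.sub_const (F η₀ t)).mul h4
  rw [(h3.hasLineDerivAt u).lineDeriv]
  congr 1
  refine (h5.hasLineDerivAt u).lineDeriv.trans ?_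
  simp [mul_comm]

/-- The derivative of a functional `η ↦ F(η, T) w - ∫ W(t) G(η, t) dt`. -/
lemma lineDeriv_functional (hF : ContDiff ℝ 1 (Function.uncurry F))
    (hG : ContDiff ℝ 1 (Function.uncurry G)) {W : ℝ → ℝ} (hW : Continuous W) (T : ℝ) (η v : E) :
    lineDeriv ℝ (fun η => F η T * W T - ∫ t in (0 : ℝ)..T, W t * G η t) η v =
      lineDeriv ℝ (fun η => F η T) η v * W T -
        ∫ t in (0 : ℝ)..T, W t * lineDeriv ℝ (fun η => G η t) η v := by
  have h3 := hasFDerivAt_partial_left (hF.differentiable one_ne_zero) η T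
  have h4 : DifferentiableAt ℝ (fun η => ∫ t in (0 : ℝ)..T, W t * G η t) η :=
    (hasFDerivAt_intervalIntegral_smul (F' := fun η t =>
        (fderiv ℝ (Function.uncurry G) (η, t)).comp (ContinuousLinearMap.inl ℝ E ℝ)) hW hG.continuous
      ((hG.continuous_fderiv one_ne_zero).clm_comp continuous_const)
      (fun η t => hasFDerivAt_partial_left (hG.differentiable one_ne_zero) η t) 0 T
      η).differentiableAt
  have h5 := (h3.mul_const (W T)).sub h4.hasFDerivAt
  rw [(h3.hasLineDerivAt v).lineDeriv, ← lineDeriv_intervalIntegral_mul hW hG,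
    h4.lineDeriv_eq_fderiv]
  refine (h5.hasLineDerivAt v).lineDeriv.trans ?_
  simp [mul_comm]

lemma contDiff_functional {E : Type} [NormedAddCommGroup E] [NormedSpace ℝ E] [ProperSpace E]
    {F G : E → ℝ → ℝ} {n : ℕ} (hF : ContDiff ℝ n (Function.uncurry F))
    (hG : ContDiff ℝ n (Function.uncurry G)) {W : ℝ → ℝ} (hW : Continuous W) (T : ℝ) :
    ContDiff ℝ n fun η => F η T * W T - ∫ t in (0 : ℝ)..T, W t * G η t :=
  ((hF.comp (contDiff_prodMk_left T)).mul contDiff_const).sub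
    (contDiff_intervalIntegral_smul hW 0 T n hG)

lemma secondPartial_functional (hF : ContDiff ℝ 2 (Function.uncurry F))
    (hG : ContDiff ℝ 2 (Function.uncurry G)) {W : ℝ → ℝ} (hW : Continuous W) (T : ℝ) (η u v : E) :
    secondPartial (fun η => F η T * W T - ∫ t in (0 : ℝ)..T, W t * G η t) η u v =
      secondPartial (fun η => F η T) η u v * W T -
        ∫ t in (0 : ℝ)..T, W t * secondPartial (fun η => G η t) η u v := by
  rw [secondPartial]
  simp_rw [lineDeriv_functional (hF.of_le one_le_two) (hG.of_le one_le_two) hW]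
  exact lineDeriv_functional (contDiff_uncurry_lineDeriv (n := 1) hF v)
    (contDiff_uncurry_lineDeriv (n := 1) hG v) hW T η u

omit [ProperSpace E] in
lemma continuous_lineDeriv_partial (hG : ContDiff ℝ 1 (Function.uncurry G)) (η v : E) :
    Continuous fun t => lineDeriv ℝ (fun η => G η t) η v :=
  (contDiff_uncurry_lineDeriv (n := 0) hG v).continuous.comp (Continuous.prodMk_right η)

omit [ProperSpace E] in
lemma continuous_secondPartial_partial (hG : ContDiff ℝ 2 (Function.uncurry G)) (η u v : E) :
    Continuous fun t => secondPartial (fun η => G η t) η u v :=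
  continuous_lineDeriv_partial (contDiff_uncurry_lineDeriv (n := 1) hG v) η u

end Functionals

/-! ### The log-likelihood of one waveform and its derivatives at the true parameters. -/

section Likelihood

variable {s : ℝ → ℝ} {c : ℝ} {L : ℕ}

lemma contDiff_signal (c : ℝ) (L : ℕ) {n : WithTop ℕ∞} (hs : ContDiff ℝ n s) :
    ContDiff ℝ n (Function.uncurry (signal s c (L := L))) := by
  have h : ContDiff ℝ n fun p : (Chan L → ℝ) × ℝ =>
      ∑ l, c * p.1 (Sum.inr l) * s (p.2 - p.1 (Sum.inl l)) := by
    refine ContDiff.sum fun l _ => ?_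
    exact ((contDiff_const.mul ((contDiff_apply ℝ ℝ (Sum.inr l)).comp contDiff_fst))).mul
      (hs.comp (contDiff_snd.sub ((contDiff_apply ℝ ℝ (Sum.inl l)).comp contDiff_fst)))
  exact h

lemma deriv_signal (hs : ContDiff ℝ 1 s) (η : Chan L → ℝ) :
    deriv (signal s c η) = signal (deriv s) c η := by
  ext t
  refine HasDerivAt.deriv ?_
  refine HasDerivAt.fun_sum fun l _ => ?_
  have h := ((hs.differentiable one_ne_zero) (t - η (Sum.inl l))).hasDerivAt.comp_sub_const t
    (η (Sum.inl l))
  exact h.const_mul _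

/-- The log-likelihood of a waveform which is a signal plus noise. -/
lemma log_waveLik_eq (hs : ContDiff ℝ 1 s) (N₀ T σ : ℝ) (η₀ : Chan L → ℝ) {W : ℝ → ℝ}
    (hW : Continuous W) (η : Chan L → ℝ) :
    Real.log (waveLik s c N₀ T (fun t => (∫ u in (0 : ℝ)..t, signal s c η₀ u) + σ * W t) η) =
      1 / N₀ * (∫ t in (0 : ℝ)..T, signal s c η₀ t ^ 2) +
        (-(1 / N₀) * (∫ t in (0 : ℝ)..T, (signal s c η t - signal s c η₀ t) ^ 2) +
        2 * σ / N₀ * (signal s c η T * W T -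
          ∫ t in (0 : ℝ)..T, W t * signal (deriv s) c η t)) := by
  have hc : ∀ η, ContDiff ℝ 1 (signal s c (L := L) η) := fun η =>
    (contDiff_signal c L hs).comp (contDiff_prodMk_right η)
  have hc0 : ∀ η, Continuous (signal s c (L := L) η) := fun η => (hc η).continuous
  have hc' : ∀ η, Continuous (deriv (signal s c (L := L) η)) := fun η =>
    (hc η).continuous_deriv le_rfl
  set M : ℝ → ℝ := fun t => ∫ u in (0 : ℝ)..t, signal s c η₀ u
  have hM : ∀ t, HasDerivAt M (signal s c η₀ t) t := fun t =>
    intervalIntegral.integral_hasDerivAt_right ((hc0 η₀).intervalIntegrable _ _)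
      ((hc0 η₀).stronglyMeasurableAtFilter _ _) (hc0 η₀).continuousAt
  have hMc : Continuous M := continuous_iff_continuousAt.2 fun t => (hM t).continuousAt
  -- On the noise-free part of the path, integration by parts undoes the definition of `obsIntegral`
  -- and returns an ordinary correlation integral.
  have hparts : ∫ t in (0 : ℝ)..T, M t * deriv (signal s c η) t =
      M T * signal s c η T - ∫ t in (0 : ℝ)..T, signal s c η₀ t * signal s c η t := by
    rw [intervalIntegral.integral_mul_deriv_eq_deriv_mul (u := M) (v := signal s c η)
      (u' := signal s c η₀)
      (fun t _ => hM t) (fun t _ => ((hc η).differentiable one_ne_zero t).hasDerivAt)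
      ((hc0 η₀).intervalIntegrable _ _) ((hc' η).intervalIntegrable _ _)]
    simp [M]
  have i1 : IntervalIntegrable (fun t => M t * deriv (signal s c η) t) volume 0 T :=
    (hMc.mul (hc' η)).intervalIntegrable _ _
  have i2 : IntervalIntegrable (fun t => σ * (W t * deriv (signal s c η) t)) volume 0 T :=
    (continuous_const.mul (hW.mul (hc' η))).intervalIntegrable _ _
  have hobs : obsIntegral T (fun t => M t + σ * W t) (signal s c η) =
      (∫ t in (0 : ℝ)..T, signal s c η₀ t * signal s c η t) +
        σ * (signal s c η T * W T - ∫ t in (0 : ℝ)..T, W t * signal (deriv s) c η t) := by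
    have : ∫ t in (0 : ℝ)..T, (M t + σ * W t) * deriv (signal s c η) t =
        (∫ t in (0 : ℝ)..T, M t * deriv (signal s c η) t) +
          σ * ∫ t in (0 : ℝ)..T, W t * deriv (signal s c η) t := by
      rw [← intervalIntegral.integral_const_mul, ← intervalIntegral.integral_add i1 i2]
      exact intervalIntegral.integral_congr fun t _ => by ring
    rw [obsIntegral, this, hparts, deriv_signal hs]
    ring
  -- Completing the square: correlation and energy combine into a squared residual, which vanishes
  -- to first order at `η₀`, and a constant.
  have hsq : ∫ t in (0 : ℝ)..T, (signal s c η t - signal s c η₀ t) ^ 2 =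
      (∫ t in (0 : ℝ)..T, signal s c η t ^ 2) +
        ((∫ t in (0 : ℝ)..T, signal s c η₀ t ^ 2) -
        2 * ∫ t in (0 : ℝ)..T, signal s c η₀ t * signal s c η t) := by
    rw [← intervalIntegral.integral_const_mul, ← intervalIntegral.integral_sub,
      ← intervalIntegral.integral_add]
    · exact intervalIntegral.integral_congr fun t _ => by ring
    all_goals refine Continuous.intervalIntegrable ?_ _ _
    · exact (hc0 η).pow 2
    · exact ((hc0 η₀).pow 2).sub (continuous_const.mul ((hc0 η₀).mul (hc0 η)))
    · exact (hc0 η₀).pow 2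
    · exact continuous_const.mul ((hc0 η₀).mul (hc0 η))
  rw [waveLik, Real.log_exp, hobs, hsq]
  ring

/-- Three derivatives of `s` are used because the noise functional contains `deriv s`, which must be
twice differentiable in the delays. -/
lemma contDiff_log_waveLik (hs : ContDiff ℝ 3 s) (N₀ T σ : ℝ) (η₀ : Chan L → ℝ) {W : ℝ → ℝ}
    (hW : Continuous W) :
    ContDiff ℝ 2 fun η : Chan L → ℝ => Real.log
      (waveLik s c N₀ T (fun t => (∫ u in (0 : ℝ)..t, signal s c η₀ u) + σ * W t) η) := by
  have hs2 : ContDiff ℝ (2 : ℕ) s := hs.of_le (by norm_num)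
  have hs' : ContDiff ℝ (2 : ℕ) (deriv s) := by
    refine ContDiff.deriv' (n := 2) ?_; norm_num; exact hs
  simp_rw [log_waveLik_eq (hs.of_le (by norm_num)) N₀ T σ η₀ hW]
  refine contDiff_const.add ((contDiff_const.mul ?_).add (contDiff_const.mul ?_))
  · exact contDiff_integral_sq (contDiff_signal c L hs2)
      ((contDiff_signal c L hs2).comp (contDiff_prodMk_right η₀)) 0 T
  · exact contDiff_functional (contDiff_signal c L hs2) (contDiff_signal c L hs') hW T

/-- The squared residual is stationary at `η₀`, so the score is purely linear in the noise path. -/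
lemma lineDeriv_log_waveLik (hs : ContDiff ℝ 3 s) (N₀ T σ : ℝ) (η₀ : Chan L → ℝ) {W : ℝ → ℝ}
    (hW : Continuous W) (v : Chan L → ℝ) :
    lineDeriv ℝ (fun η => Real.log
      (waveLik s c N₀ T (fun t => (∫ u in (0 : ℝ)..t, signal s c η₀ u) + σ * W t) η)) η₀ v =
      2 * σ / N₀ * (lineDeriv ℝ (fun η => signal s c η T) η₀ v * W T -
        ∫ t in (0 : ℝ)..T, W t * lineDeriv ℝ (fun η => signal (deriv s) c η t) η₀ v) := by
  have hs2 : ContDiff ℝ (1 : ℕ) s := hs.of_le (by norm_num)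
  have hs' : ContDiff ℝ (1 : ℕ) (deriv s) := by
    refine ContDiff.deriv' (n := 1) ?_; exact hs.of_le (by norm_num)
  simp_rw [log_waveLik_eq (hs.of_le (by norm_num)) N₀ T σ η₀ hW]
  have hg : ContDiff ℝ (1 : ℕ) (signal s c η₀) :=
    (contDiff_signal c L hs2).comp (contDiff_prodMk_right η₀)
  have d1 := ((contDiff_integral_sq (contDiff_signal c L hs2) hg 0
    T).differentiable (by simp)) η₀
  have d2 := ((contDiff_functional (contDiff_signal c L hs2)
    (contDiff_signal c L hs') hW T).differentiable (by simp)) η₀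
  have h := ((d1.hasFDerivAt.const_mul (-(1 / N₀))).add
    (d2.hasFDerivAt.const_mul (2 * σ / N₀))).const_add
      (1 / N₀ * (∫ t in (0 : ℝ)..T, signal s c η₀ t ^ 2))
  have e1 := lineDeriv_integral_sq (contDiff_signal c L hs2) hg 0 T η₀ v
  rw [d1.lineDeriv_eq_fderiv] at e1
  have e2 := lineDeriv_functional (contDiff_signal c L hs2)
    (contDiff_signal c L hs') hW T η₀ v
  rw [d2.lineDeriv_eq_fderiv] at e2
  refine (h.hasLineDerivAt v).lineDeriv.trans ?_
  rw [← e2]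
  simp [e1]

/-- The Gram term does not involve the noise, and the remainder is linear in the noise path;
averaging over the noise leaves only the Gram term. -/
lemma secondPartial_log_waveLik (hs : ContDiff ℝ 3 s) (N₀ T σ : ℝ) (η₀ : Chan L → ℝ) {W : ℝ → ℝ}
    (hW : Continuous W) (u v : Chan L → ℝ) :
    secondPartial (fun η => Real.log
      (waveLik s c N₀ T (fun t => (∫ u in (0 : ℝ)..t, signal s c η₀ u) + σ * W t) η)) η₀ u v =
      -(2 / N₀ * ∫ t in (0 : ℝ)..T, lineDeriv ℝ (fun η => signal s c η t) η₀ u *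
        lineDeriv ℝ (fun η => signal s c η t) η₀ v) +
      2 * σ / N₀ * (secondPartial (fun η => signal s c η T) η₀ u v * W T -
        ∫ t in (0 : ℝ)..T, W t * secondPartial (fun η => signal (deriv s) c η t) η₀ u v) := by
  have hs2 : ContDiff ℝ (2 : ℕ) s := hs.of_le (by norm_num)
  have hs' : ContDiff ℝ (2 : ℕ) (deriv s) := by
    refine ContDiff.deriv' (n := 2) ?_; norm_num; exact hs
  simp_rw [log_waveLik_eq (hs.of_le (by norm_num)) N₀ T σ η₀ hW]
  have hg : ContDiff ℝ (2 : ℕ) (signal s c η₀) :=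
    (contDiff_signal c L hs2).comp (contDiff_prodMk_right η₀)
  rw [secondPartial_const_add, secondPartial_add, secondPartial_const_mul, secondPartial_const_mul,
    secondPartial_integral_sq (contDiff_signal c L hs2),
    secondPartial_functional (contDiff_signal c L hs2) (contDiff_signal c L hs') hW]
  · ring
  · exact (contDiff_const.mul (contDiff_integral_sq (contDiff_signal c L hs2) hg 0 T)).contDiffAt
  · exact (contDiff_const.mul (contDiff_functional (contDiff_signal c L hs2)
      (contDiff_signal c L hs') hW T)).contDiffAt

end Likelihood

/-! ### The channel law and the score of the prior. -/

namespace Network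

variable {Na Nb : ℕ} (N : Network Na Nb)

lemma trueDist_pos (w : N.Link) : 0 < N.trueDist w :=
  dist_pos.2 (N.separated w.1 w.2)

/-- The channel vector with given random components. -/
def chanOf (w : N.Link) (κ : {i // i ∈ N.random w} → ℝ) : Chan (N.paths w) → ℝ :=
  fun i => if h : i ∈ N.random w then κ ⟨i, h⟩ else N.chanTrue w i

/-- The random components of a channel vector. -/
def randomPart (w : N.Link) : (Chan (N.paths w) → ℝ) →L[ℝ] ({i // i ∈ N.random w} → ℝ) :=
  ContinuousLinearMap.pi fun i => ContinuousLinearMap.proj i.1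

@[simp] lemma randomPart_apply (w : N.Link) (κ : Chan (N.paths w) → ℝ)
    (i : {i // i ∈ N.random w}) : N.randomPart w κ i = κ i := rfl

@[simp] lemma randomPart_chanOf (w : N.Link) (κ : {i // i ∈ N.random w} → ℝ) :
    N.randomPart w (N.chanOf w κ) = κ := by
  ext i; simp [chanOf]

/-- An embedding transports integrals, integrability and almost everywhere statements for arbitrary
functions, so nothing has to be known about measurability of derivatives of the log-prior. -/
lemma measurableEmbedding_chanOf (w : N.Link) : MeasurableEmbedding (N.chanOf w) := by
  refine Measurable.measurableEmbedding ?_ ?_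
  · refine measurable_pi_lambda _ fun i => ?_
    unfold chanOf
    by_cases h : i ∈ N.random w
    · simpa [h] using measurable_pi_apply _
    · simp [h]
  · intro κ κ' h
    rw [← N.randomPart_chanOf w κ, h, N.randomPart_chanOf]

lemma chanLaw_eq (w : N.Link) :
    N.chanLaw w = (volume.withDensity fun κ : {i // i ∈ N.random w} → ℝ =>
      ENNReal.ofReal (N.prior w (N.trueDist w) κ)).map (N.chanOf w) := rfl

lemma aemeasurable_ofReal_prior (w : N.Link) :
    AEMeasurable fun κ : {i // i ∈ N.random w} → ℝ =>
      ENNReal.ofReal (N.prior w (N.trueDist w) κ) :=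
  (N.prior_integrable w _ (N.trueDist_pos w)).aemeasurable.ennreal_ofReal

instance isProbabilityMeasure_chanLaw (w : N.Link) : IsProbabilityMeasure (N.chanLaw w) := by
  rw [chanLaw_eq]
  have : IsProbabilityMeasure (volume.withDensity fun κ : {i // i ∈ N.random w} → ℝ =>
      ENNReal.ofReal (N.prior w (N.trueDist w) κ)) := by
    constructor
    rw [withDensity_apply _ MeasurableSet.univ, Measure.restrict_univ,
      ← ofReal_integral_eq_lintegral_ofReal (N.prior_integrable w _ (N.trueDist_pos w))
        (ae_of_all _ (N.prior_nonneg w _ (N.trueDist_pos w))),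
      N.prior_integral w _ (N.trueDist_pos w), ENNReal.ofReal_one]
  exact Measure.isProbabilityMeasure_map (N.measurableEmbedding_chanOf w).measurable.aemeasurable

lemma integrable_chanLaw_iff (w : N.Link) (g : (Chan (N.paths w) → ℝ) → ℝ) :
    Integrable g (N.chanLaw w) ↔
      Integrable fun κ => N.prior w (N.trueDist w) κ * g (N.chanOf w κ) := by
  rw [chanLaw_eq, (N.measurableEmbedding_chanOf w).integrable_map_iff,
    integrable_withDensity_iff_integrable_smul₀' (N.aemeasurable_ofReal_prior w)
      (ae_of_all _ fun _ => ENNReal.ofReal_lt_top)]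
  refine integrable_congr (ae_of_all _ fun κ => ?_)
  simp [ENNReal.toReal_ofReal (N.prior_nonneg w _ (N.trueDist_pos w) κ)]

lemma integral_chanLaw (w : N.Link) (g : (Chan (N.paths w) → ℝ) → ℝ) :
    ∫ κ, g κ ∂(N.chanLaw w) =
      ∫ κ, N.prior w (N.trueDist w) κ * g (N.chanOf w κ) := by
  rw [chanLaw_eq, (N.measurableEmbedding_chanOf w).integral_map,
    integral_withDensity_eq_integral_toReal_smul₀ (N.aemeasurable_ofReal_prior w)
      (ae_of_all _ fun _ => ENNReal.ofReal_lt_top)]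
  refine integral_congr_ae (ae_of_all _ fun κ => ?_)
  simp [ENNReal.toReal_ofReal (N.prior_nonneg w _ (N.trueDist_pos w) κ)]

lemma ae_chanLaw_iff (w : N.Link) (p : (Chan (N.paths w) → ℝ) → Prop) :
    (∀ᵐ κ ∂(N.chanLaw w), p κ) ↔
      ∀ᵐ κ, 0 < N.prior w (N.trueDist w) κ → p (N.chanOf w κ) := by
  rw [chanLaw_eq, (N.measurableEmbedding_chanOf w).ae_map_iff,
    ae_withDensity_iff' (N.aemeasurable_ofReal_prior w)]
  simp [ENNReal.ofReal_eq_zero]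

/-- The distance together with the random components of the channel. -/
def pairRandomPart (w : N.Link) :
    ℝ × (Chan (N.paths w) → ℝ) →L[ℝ] ℝ × ({i // i ∈ N.random w} → ℝ) :=
  (ContinuousLinearMap.id ℝ ℝ).prodMap (N.randomPart w)

lemma chanDensity_eq (w : N.Link) (y : ℝ × (Chan (N.paths w) → ℝ)) :
    N.chanDensity w y.1 y.2 = Function.uncurry (N.prior w) (N.pairRandomPart w y) := rfl

lemma pairRandomPart_chanOf (w : N.Link) (x : ℝ) (κ : {i // i ∈ N.random w} → ℝ) :
    N.pairRandomPart w (x, N.chanOf w κ) = (x, κ) := by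
  simp [pairRandomPart]

/-- At a possible channel the density is positive and twice continuously differentiable. -/
lemma ae_chanLaw_regular (w : N.Link) (h : N.PriorRegular w) :
    ∀ᵐ κ ∂(N.chanLaw w), 0 < N.chanDensity w (N.trueDist w) κ ∧
      ContDiffAt ℝ 2 (fun y : ℝ × (Chan (N.paths w) → ℝ) => N.chanDensity w y.1 y.2)
        (N.trueDist w, κ) := by
  rw [ae_chanLaw_iff]
  filter_upwards [h.contDiffAt] with κ hκ hpos
  have e := N.pairRandomPart_chanOf w (N.trueDist w) κ
  constructor
  · have := N.chanDensity_eq w (N.trueDist w, N.chanOf w κ)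
    rw [e] at this
    simpa [this] using hpos
  · rw [← e] at hκ
    exact hκ.comp _ (N.pairRandomPart w).contDiff.contDiffAt

lemma ae_contDiffAt_logPrior (w : N.Link) (h : N.PriorRegular w) :
    ∀ᵐ κ ∂(N.chanLaw w), ContDiffAt ℝ 2 (N.logPrior w) (N.trueDist w, κ) := by
  filter_upwards [N.ae_chanLaw_regular w h] with κ hκ
  exact hκ.2.log hκ.1.ne'

/-- The derivative of the prior in the distance is integrable, with integral zero. -/
lemma integral_deriv_prior (w : N.Link) {ε : ℝ} (hε : 0 < ε)
    {b : ({i // i ∈ N.random w} → ℝ) → ℝ≥0} (hb : Integrable fun κ => (b κ : ℝ))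
    {x₀ : ℝ} (hx₀ : 0 < x₀)
    (hlip : ∀ᵐ κ, LipschitzOnWith (b κ) (fun x => N.prior w x κ) (Metric.ball x₀ ε))
    {f' : ({i // i ∈ N.random w} → ℝ) → ℝ}
    (hd : ∀ᵐ κ, HasDerivAt (fun x => N.prior w x κ) (f' κ) x₀) :
    Integrable f' ∧ ∫ κ, f' κ = 0 := by
  have hpos : ∀ᶠ x in 𝓝 x₀, 0 < x := eventually_gt_nhds hx₀
  have hmeas : ∀ᶠ x in 𝓝 x₀, AEStronglyMeasurable (N.prior w x) volume := by
    filter_upwards [hpos] with x hx using (N.prior_integrable w x hx).aestronglyMeasurable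
  -- The derivative is an almost everywhere limit of difference quotients with steps `1 / (n + 1)`.
  have hm' : AEStronglyMeasurable f' volume := by
    have hseq : Tendsto (fun n : ℕ => 1 / ((n : ℝ) + 1)) atTop (𝓝[≠] 0) := by
      refine tendsto_nhdsWithin_iff.2 ⟨tendsto_one_div_add_atTop_nhds_zero_nat,
        Eventually.of_forall fun n => ?_⟩
      have : (0 : ℝ) < 1 / ((n : ℝ) + 1) := by positivity
      exact this.ne'
    refine aestronglyMeasurable_of_tendsto_ae atTop
      (f := fun (n : ℕ) κ => (1 / ((n : ℝ) + 1))⁻¹ •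
        (N.prior w (x₀ + 1 / ((n : ℝ) + 1)) κ - N.prior w x₀ κ)) (fun n => ?_) ?_
    · exact ((N.prior_integrable w _ (by positivity)).aestronglyMeasurable.sub
        (N.prior_integrable w _ hx₀).aestronglyMeasurable).const_smul (1 / ((n : ℝ) + 1))⁻¹
    · filter_upwards [hd] with κ hκ
      exact (hasDerivAt_iff_tendsto_slope_zero.1 hκ).comp hseq
  have key := hasDerivAt_integral_of_dominated_loc_of_lip (bound := fun κ => (b κ : ℝ))
    (Metric.ball_mem_nhds x₀ hε) hmeas (N.prior_integrable w x₀ hx₀) hm'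
    (by filter_upwards [hlip] with κ hκ; simpa using hκ) hb hd
  refine ⟨key.1, ?_⟩
  -- The total mass is constant near `x₀`, so its derivative, which is the integral of `f'`, is
  -- zero.
  have hc : (fun x => ∫ κ, N.prior w x κ) =ᶠ[𝓝 x₀] fun _ => 1 := by
    filter_upwards [hpos] with x hx using N.prior_integral w x hx
  exact key.2.unique ((hasDerivAt_const x₀ (1 : ℝ)).congr_of_eventuallyEq hc)

lemma hasDerivAt_fst {ι : Type*} [Fintype ι] {f : ℝ → (ι → ℝ) → ℝ} {x : ℝ} {κ : ι → ℝ}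
    (h : DifferentiableAt ℝ (Function.uncurry f) (x, κ)) :
    HasDerivAt (fun x => f x κ) (fderiv ℝ (Function.uncurry f) (x, κ) (1, 0)) x := by
  have h1 : HasDerivAt (fun x : ℝ => (x, κ)) ((1 : ℝ), (0 : ι → ℝ)) x :=
    (hasDerivAt_id x).prodMk (hasDerivAt_const x κ)
  exact h.hasFDerivAt.comp_hasDerivAt x h1

/-- The score of the prior with respect to the distance has mean zero. -/
lemma integral_prior_score (w : N.Link) (h : N.PriorRegular w) :
    Integrable (fun κ => fderiv ℝ (N.logPrior w) (N.trueDist w, κ) (1, 0)) (N.chanLaw w) ∧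
      ∫ κ, fderiv ℝ (N.logPrior w) (N.trueDist w, κ) (1, 0) ∂(N.chanLaw w) = 0 := by
  obtain ⟨ε, hε, b, hb, hlip⟩ := h.lipschitz
  have key := N.integral_deriv_prior w hε hb (N.trueDist_pos w) hlip
    (f' := fun κ => fderiv ℝ (Function.uncurry (N.prior w)) (N.trueDist w, κ) (1, 0))
    (by filter_upwards [h.contDiffAt] with κ hκ
        exact hasDerivAt_fst (hκ.differentiableAt two_ne_zero))
  -- The identity `f · ∂ log f = ∂ f`, valid also at zeros of the density: there the distance is a
  -- local minimum of a nonnegative function, so `∂ f` vanishes as well.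
  have he : (fun κ => N.prior w (N.trueDist w) κ *
      fderiv ℝ (N.logPrior w) (N.trueDist w, N.chanOf w κ) (1, 0)) =ᵐ[volume]
      fun κ => fderiv ℝ (Function.uncurry (N.prior w)) (N.trueDist w, κ) (1, 0) := by
    filter_upwards [h.contDiffAt] with κ hκ
    have hd := hκ.differentiableAt two_ne_zero
    rcases (N.prior_nonneg w _ (N.trueDist_pos w) κ).eq_or_lt with h0 | h0
    · have hmin : IsLocalMin (fun x => N.prior w x κ) (N.trueDist w) := by
        filter_upwards [eventually_gt_nhds (N.trueDist_pos w)] with x hx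
        rw [← h0]; exact N.prior_nonneg w x hx κ
      rw [← h0, hmin.hasDerivAt_eq_zero (hasDerivAt_fst hd), zero_mul]
    · have e := N.pairRandomPart_chanOf w (N.trueDist w) κ
      have h1 : HasFDerivAt (Function.uncurry (N.prior w))
          (fderiv ℝ (Function.uncurry (N.prior w)) (N.trueDist w, κ))
          (N.pairRandomPart w (N.trueDist w, N.chanOf w κ)) := by
        rw [e]; exact hd.hasFDerivAt
      have h2 := (h1.comp (N.trueDist w, N.chanOf w κ)
        (N.pairRandomPart w).hasFDerivAt).log (by rw [Function.comp_apply, e]; exact h0.ne')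
      have h3 : fderiv ℝ (N.logPrior w) (N.trueDist w, N.chanOf w κ) = _ := h2.fderiv
      rw [h3]
      have h4 : N.pairRandomPart w (1, 0) = (1, 0) := by simp [pairRandomPart]
      simp only [Function.comp_apply, e, _root_.smul_apply, ContinuousLinearMap.comp_apply, h4,
        smul_eq_mul, Function.uncurry_apply_pair]
      rw [mul_inv_cancel_left₀ h0.ne']
  refine ⟨(N.integrable_chanLaw_iff w _).2 (key.1.congr he.symm), ?_⟩
  rw [integral_chanLaw, integral_congr_ae he, key.2]

end Network

/-! ### Zero-mean scores, and `Ψ`, `Ξ` as bilinear forms. -/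

namespace Network

variable {Na Nb : ℕ} (N : Network Na Nb)
  {Ω : Type*} [MeasurableSpace Ω] {Pr : Measure Ω} [IsProbabilityMeasure Pr]
  {B : N.Link → ℝ≥0 → Ω → ℝ}

instance isProbabilityMeasure_jointLaw : IsProbabilityMeasure (N.jointLaw Pr) := by
  unfold jointLaw; infer_instance

lemma measurePreserving_channel (w : N.Link) :
    MeasurePreserving (fun z : N.Channels × Ω => z.1 w) (N.jointLaw Pr) (N.chanLaw w) :=
  (measurePreserving_eval N.chanLaw w).comp measurePreserving_fst

omit [IsProbabilityMeasure Pr] in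
lemma ae_continuous_path (hB : N.IsNoise Pr B) :
    ∀ᵐ z ∂(N.jointLaw Pr), ∀ w, Continuous fun t => B w t z.2 := by
  have h : ∀ᵐ ω ∂Pr, ∀ w, Continuous fun t => B w t ω :=
    ae_all_iff.2 fun w => (hB.brownian w).cont
  exact Measure.quasiMeasurePreserving_snd.ae h

lemma integrable_comp_channel (w : N.Link) {g : (Chan (N.paths w) → ℝ) → ℝ}
    (hg : Integrable g (N.chanLaw w)) :
    Integrable (fun z : N.Channels × Ω => g (z.1 w)) (N.jointLaw Pr) :=
  (N.measurePreserving_channel (Pr := Pr) w).integrable_comp_of_integrable hg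

lemma integral_comp_channel (w : N.Link) {g : (Chan (N.paths w) → ℝ) → ℝ}
    (hg : Integrable g (N.chanLaw w)) :
    ∫ z : N.Channels × Ω, g (z.1 w) ∂(N.jointLaw Pr) = ∫ κ, g κ ∂(N.chanLaw w) := by
  have h := N.measurePreserving_channel (Pr := Pr) w
  conv_rhs => rw [← h.map_eq]
  rw [integral_map h.measurable.aemeasurable (by rw [h.map_eq]; exact hg.aestronglyMeasurable)]

omit [MeasurableSpace Ω] in
lemma contDiff_linkLogLik (hs : ContDiff ℝ 3 N.s) {z : N.Channels × Ω} {w : N.Link}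
    (h : Continuous fun t => B w t z.2) : ContDiff ℝ 2 (N.linkLogLik B z w) :=
  contDiff_log_waveLik hs N.N₀ N.T (Real.sqrt (N.N₀ / 2)) (N.trueDelayAmp z.1 w)
    (W := fun t : ℝ => B w t.toNNReal z.2) (h.comp continuous_real_toNNReal)

/-- Given the channels, the score of a waveform has mean zero. -/
lemma integral_noise_score (hB : N.IsNoise Pr B) (hs : ContDiff ℝ 3 N.s) (w : N.Link)
    (κ : N.Channels) (v : Chan (N.paths w) → ℝ) :
    ∫ ω, lineDeriv ℝ (N.linkLogLik B (κ, ω) w) (N.trueDelayAmp κ w) v ∂Pr = 0 := by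
  have hs' : ContDiff ℝ 1 (deriv N.s) := by
    refine ContDiff.deriv' (n := 1) ?_; exact hs.of_le (by norm_num)
  have h1 := IsBrownianReal.integrable_functional (hB.brownian w)
    (lineDeriv ℝ (fun η => signal N.s N.c η N.T) (N.trueDelayAmp κ w) v)
    (continuous_lineDeriv_partial (contDiff_signal N.c (N.paths w) hs') (N.trueDelayAmp κ w) v)
    N.T_pos.le
  have h2 : (fun ω => lineDeriv ℝ (N.linkLogLik B (κ, ω) w) (N.trueDelayAmp κ w) v) =ᵐ[Pr]
      fun ω => 2 * Real.sqrt (N.N₀ / 2) / N.N₀ *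
        (lineDeriv ℝ (fun η => signal N.s N.c η N.T) (N.trueDelayAmp κ w) v *
          B w N.T.toNNReal ω - ∫ t in (0 : ℝ)..N.T, B w t.toNNReal ω *
          lineDeriv ℝ (fun η => signal (deriv N.s) N.c η t) (N.trueDelayAmp κ w) v) := by
    filter_upwards [(hB.brownian w).cont] with ω hω
    exact lineDeriv_log_waveLik hs N.N₀ N.T (Real.sqrt (N.N₀ / 2)) (N.trueDelayAmp κ w)
      (W := fun t : ℝ => B w t.toNNReal ω) (hω.comp continuous_real_toNNReal) v
  rw [integral_congr_ae h2, integral_const_mul, h1.2, mul_zero]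

lemma integral_score (hB : N.IsNoise Pr B) (hs : ContDiff ℝ 3 N.s) (w : N.Link)
    (v : Chan (N.paths w) → ℝ)
    (hi : Integrable (fun z => lineDeriv ℝ (N.linkLogLik B z w) (N.trueDelayAmp z.1 w) v)
      (N.jointLaw Pr)) :
    ∫ z, lineDeriv ℝ (N.linkLogLik B z w) (N.trueDelayAmp z.1 w) v ∂(N.jointLaw Pr) = 0 := by
  rw [jointLaw, integral_prod _ hi]
  simp only [N.integral_noise_score hB hs, integral_zero]

/-- Given the channels, the Fisher information of a waveform is nonnegative. -/
lemma integral_noise_info_nonneg (hB : N.IsNoise Pr B) (hs : ContDiff ℝ 3 N.s) (w : N.Link)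
    (κ : N.Channels) (v : Chan (N.paths w) → ℝ) :
    0 ≤ ∫ ω, -secondPartial (N.linkLogLik B (κ, ω) w) (N.trueDelayAmp κ w) v v ∂Pr := by
  have hs' : ContDiff ℝ 2 (deriv N.s) := by
    refine ContDiff.deriv' (n := 2) ?_; norm_num; exact hs
  have h1 := IsBrownianReal.integrable_functional (hB.brownian w)
    (secondPartial (fun η => signal N.s N.c η N.T) (N.trueDelayAmp κ w) v v)
    (continuous_secondPartial_partial (contDiff_signal N.c (N.paths w) hs')
      (N.trueDelayAmp κ w) v v)
    N.T_pos.le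
  have h2 : (fun ω => -secondPartial (N.linkLogLik B (κ, ω) w) (N.trueDelayAmp κ w) v v) =ᵐ[Pr]
      fun ω => 2 / N.N₀ * (∫ t in (0 : ℝ)..N.T,
        lineDeriv ℝ (fun η => signal N.s N.c η t) (N.trueDelayAmp κ w) v *
        lineDeriv ℝ (fun η => signal N.s N.c η t) (N.trueDelayAmp κ w) v) -
        2 * Real.sqrt (N.N₀ / 2) / N.N₀ *
        (secondPartial (fun η => signal N.s N.c η N.T) (N.trueDelayAmp κ w) v v *
          B w N.T.toNNReal ω - ∫ t in (0 : ℝ)..N.T, B w t.toNNReal ω *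
          secondPartial (fun η => signal (deriv N.s) N.c η t) (N.trueDelayAmp κ w) v v) := by
    filter_upwards [(hB.brownian w).cont] with ω hω
    have := secondPartial_log_waveLik (c := N.c) hs N.N₀ N.T (Real.sqrt (N.N₀ / 2)) (N.trueDelayAmp κ w)
      (W := fun t : ℝ => B w t.toNNReal ω) (hω.comp continuous_real_toNNReal) v v
    refine (congrArg Neg.neg this).trans ?_
    ring
  -- The noise functional is centered; what remains is the energy of the derivative of the signal
  -- along `v`.
  rw [integral_congr_ae h2, integral_sub (integrable_const _) (h1.1.const_mul _),
    integral_const_mul _ fun ω => secondPartial _ _ v v * _ - _, h1.2, mul_zero, sub_zero,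
    integral_const, probReal_univ, one_smul]
  have hN := N.N₀_pos
  exact mul_nonneg (by positivity)
    (intervalIntegral.integral_nonneg N.T_pos.le fun t _ => mul_self_nonneg _)

omit [IsProbabilityMeasure Pr] in
/-- `Ψ` as a bilinear form. -/
lemma integral_linkLogLik_bilin (hB : N.IsNoise Pr B) (hs : ContDiff ℝ 3 N.s)
    (hinfo : N.FiniteInfo Pr B) (w : N.Link) (a b : Chan (N.paths w) → ℝ) :
    Integrable (fun z => secondPartial (N.linkLogLik B z w) (N.trueDelayAmp z.1 w) a b)
      (N.jointLaw Pr) ∧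
    ∫ z, -secondPartial (N.linkLogLik B z w) (N.trueDelayAmp z.1 w) a b ∂(N.jointLaw Pr) =
      a ⬝ᵥ (N.Psi Pr B w *ᵥ b) := by
  have he : (fun z => secondPartial (N.linkLogLik B z w) (N.trueDelayAmp z.1 w) a b)
      =ᵐ[N.jointLaw Pr] fun z => ∑ i, ∑ j, a i * b j *
        secondPartial (N.linkLogLik B z w) (N.trueDelayAmp z.1 w)
          (Pi.single i 1) (Pi.single j 1) := by
    filter_upwards [N.ae_continuous_path hB] with z hz
    conv_lhs => rw [pi_eq_sum_single a, pi_eq_sum_single b]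
    exact secondPartial_sum_sum (N.contDiff_linkLogLik hs (hz w)).contDiffAt _ a b
  have hi : ∀ i j, Integrable (fun z => a i * b j *
        secondPartial (N.linkLogLik B z w) (N.trueDelayAmp z.1 w)
          (Pi.single i 1) (Pi.single j 1)) (N.jointLaw Pr) := fun i j =>
    (hinfo.lik w i j).const_mul _
  refine ⟨(integrable_finsetSum _ fun i _ => integrable_finsetSum _ fun j _ =>
    hi i j).congr he.symm, ?_⟩
  rw [integral_neg, integral_congr_ae he, integral_finsetSum _ fun i _ =>
    integrable_finsetSum _ fun j _ => hi i j]
  simp only [dotProduct, Matrix.mulVec, Finset.mul_sum, Psi, Matrix.of_apply]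
  rw [← Finset.sum_neg_distrib]
  refine Finset.sum_congr rfl fun i _ => ?_
  rw [integral_finsetSum _ fun j _ => hi i j, ← Finset.sum_neg_distrib]
  refine Finset.sum_congr rfl fun j _ => ?_
  rw [integral_const_mul, integral_neg]
  ring

/-- The sign already holds conditionally on the channels, and Fubini averages it over them. -/
lemma Psi_nonneg (hB : N.IsNoise Pr B) (hs : ContDiff ℝ 3 N.s)
    (hinfo : N.FiniteInfo Pr B) (w : N.Link) (a : Chan (N.paths w) → ℝ) :
    0 ≤ a ⬝ᵥ (N.Psi Pr B w *ᵥ a) := by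
  have h := N.integral_linkLogLik_bilin hB hs hinfo w a a
  rw [← h.2, jointLaw, integral_prod (fun z => -secondPartial (N.linkLogLik B z w) (N.trueDelayAmp z.1 w) a a)
    h.1.neg]
  exact integral_nonneg fun κ => N.integral_noise_info_nonneg hB hs w κ a

omit [IsProbabilityMeasure Pr] in
lemma Psi_symm (hB : N.IsNoise Pr B) (hs : ContDiff ℝ 3 N.s) (w : N.Link) :
    (N.Psi Pr B w)ᵀ = N.Psi Pr B w := by
  ext i j
  simp only [Matrix.transpose_apply, Psi, Matrix.of_apply]
  refine integral_congr_ae ?_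
  filter_upwards [N.ae_continuous_path hB] with z hz
  rw [secondPartial_comm (N.contDiff_linkLogLik hs (hz w)).contDiffAt]

/-- The vector of coefficients of a pair (distance, vector) in the directions `pairDir`. -/
def pairCoeff {ι : Type*} (y : ℝ × (ι → ℝ)) : Option ι → ℝ := fun o => o.elim y.1 y.2

omit [IsProbabilityMeasure Pr] in
/-- `Ξ` as a bilinear form. -/
lemma integral_logPrior_bilin (hprior : ∀ w, N.PriorRegular w)
    (hinfo : N.FiniteInfo Pr B) (w : N.Link) (a b : ℝ × (Chan (N.paths w) → ℝ)) :
    Integrable (fun κ => secondPartial (N.logPrior w) (N.trueDist w, κ) a b) (N.chanLaw w) ∧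
    ∫ κ, -secondPartial (N.logPrior w) (N.trueDist w, κ) a b ∂(N.chanLaw w) =
      pairCoeff a ⬝ᵥ (N.Xi w *ᵥ pairCoeff b) := by
  have he : (fun κ => secondPartial (N.logPrior w) (N.trueDist w, κ) a b)
      =ᵐ[N.chanLaw w] fun κ => ∑ i, ∑ j, pairCoeff a i * pairCoeff b j *
        secondPartial (N.logPrior w) (N.trueDist w, κ) (pairDir i) (pairDir j) := by
    filter_upwards [N.ae_contDiffAt_logPrior w (hprior w)] with κ hκ
    conv_lhs => rw [pair_eq_sum_pairDir a, pair_eq_sum_pairDir b]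
    exact secondPartial_sum_sum hκ _ (pairCoeff a) (pairCoeff b)
  have hi : ∀ i j, Integrable (fun κ => pairCoeff a i * pairCoeff b j *
        secondPartial (N.logPrior w) (N.trueDist w, κ) (pairDir i) (pairDir j))
        (N.chanLaw w) := fun i j =>
    (hinfo.prior w i j).const_mul _
  refine ⟨(integrable_finsetSum _ fun i _ => integrable_finsetSum _ fun j _ =>
    hi i j).congr he.symm, ?_⟩
  rw [integral_neg, integral_congr_ae he, integral_finsetSum _ fun i _ =>
    integrable_finsetSum _ fun j _ => hi i j]
  simp only [dotProduct, Matrix.mulVec, Finset.mul_sum, Xi, Matrix.of_apply]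
  rw [← Finset.sum_neg_distrib]
  refine Finset.sum_congr rfl fun i _ => ?_
  rw [integral_finsetSum _ fun j _ => hi i j, ← Finset.sum_neg_distrib]
  refine Finset.sum_congr rfl fun j _ => ?_
  rw [integral_const_mul, integral_neg]
  ring

lemma Xi_symm (hprior : ∀ w, N.PriorRegular w) (w : N.Link) : (N.Xi w)ᵀ = N.Xi w := by
  ext i j
  simp only [Matrix.transpose_apply, Xi, Matrix.of_apply]
  refine integral_congr_ae ?_
  filter_upwards [N.ae_contDiffAt_logPrior w (hprior w)] with κ hκ
  rw [secondPartial_comm hκ]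

end Network

/-! ### The distance of a link and its gradient. -/

namespace Network

variable {Na Nb : ℕ} (N : Network Na Nb)

/-- The distance of a link as a function of the coordinates of the agents. -/
noncomputable def distFun (w : N.Link) (x : Fin Na × Fin 2 → ℝ) : ℝ :=
  N.linkDist (fun k => !₂[x (k, 0), x (k, 1)]) w

/-- The true coordinates of the agents. -/
noncomputable def truePos : Fin Na × Fin 2 → ℝ := fun a => N.agentPos a.1 a.2

/-- The linear part of a coordinate of a node. -/
noncomputable def nodeCoord (j : Fin Na ⊕ Fin Nb) (r : Fin 2) : (Fin Na × Fin 2 → ℝ) →L[ℝ] ℝ :=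
  Sum.elim (fun m => ContinuousLinearMap.proj (m, r)) (fun _ => 0) j

/-- The constant part of a coordinate of a node. -/
noncomputable def nodeConst (j : Fin Na ⊕ Fin Nb) (r : Fin 2) : ℝ :=
  Sum.elim (fun _ => 0) (fun b => N.anchorPos b r) j

/-- Writing each node coordinate as linear part plus constant treats agents and anchors by a single
formula. -/
lemma distFun_eq (w : N.Link) (x : Fin Na × Fin 2 → ℝ) :
    N.distFun w x = Real.sqrt
      ((x (w.1.1, 0) - (nodeCoord w.1.2 0 x + N.nodeConst w.1.2 0)) ^ 2 +
        (x (w.1.1, 1) - (nodeCoord w.1.2 1 x + N.nodeConst w.1.2 1)) ^ 2) := by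
  obtain ⟨⟨k, j⟩, hw⟩ := w
  rw [distFun, linkDist, EuclideanSpace.dist_eq, Fin.sum_univ_two]
  cases j <;> simp [pos, nodeCoord, nodeConst, Real.dist_eq, sq_abs]

lemma nodeCoord_truePos (j : Fin Na ⊕ Fin Nb) (r : Fin 2) :
    nodeCoord j r N.truePos + N.nodeConst j r = N.pos N.agentPos j r := by
  cases j <;> simp [nodeCoord, nodeConst, pos, truePos]

lemma distFun_truePos (w : N.Link) : N.distFun w N.truePos = N.trueDist w := by
  have : (fun k => !₂[N.truePos (k, 0), N.truePos (k, 1)]) = N.agentPos := by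
    ext k r
    fin_cases r <;> simp [truePos]
  rw [distFun, this, trueDist]

lemma sq_sum_pos (w : N.Link) :
    0 < (N.agentPos w.1.1 0 - N.pos N.agentPos w.1.2 0) ^ 2 +
      (N.agentPos w.1.1 1 - N.pos N.agentPos w.1.2 1) ^ 2 := by
  have h := N.trueDist_pos w
  rw [← distFun_truePos, distFun_eq, Real.sqrt_pos] at h
  simpa [nodeCoord_truePos, truePos] using h

lemma contDiffAt_distFun (w : N.Link) : ContDiffAt ℝ 2 (N.distFun w) N.truePos := by
  have h : N.distFun w = fun x => _ := funext (N.distFun_eq w)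
  rw [h]
  refine ContDiffAt.sqrt ?_ ?_
  · have h1 : ∀ r, ContDiff ℝ 2 fun x : Fin Na × Fin 2 → ℝ =>
        (x (w.1.1, r) - (nodeCoord w.1.2 r x + N.nodeConst w.1.2 r)) ^ 2 := fun r =>
      ((contDiff_apply ℝ ℝ (w.1.1, r)).sub
        ((nodeCoord w.1.2 r).contDiff.add contDiff_const)).pow 2
    exact ((h1 0).add (h1 1)).contDiffAt
  · simp only [nodeCoord_truePos]
    exact (N.sq_sum_pos w).ne'

/-- The unit vector in the direction of an angle. -/
noncomputable def unitVec (φ : ℝ) : Fin 2 → ℝ := ![Real.cos φ, Real.sin φ]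

lemma rdm_apply (φ : ℝ) (r r' : Fin 2) : rdm φ r r' = unitVec φ r * unitVec φ r' := by
  fin_cases r <;> fin_cases r' <;> simp [rdm, unitVec] <;> ring

lemma trueDist_mul_unitVec (w : N.Link) (r : Fin 2) :
    N.trueDist w * unitVec (N.angle w.1.1 w.1.2) r =
      N.agentPos w.1.1 r - N.pos N.agentPos w.1.2 r := by
  set ζ : ℂ := ⟨N.agentPos w.1.1 0 - N.pos N.agentPos w.1.2 0,
    N.agentPos w.1.1 1 - N.pos N.agentPos w.1.2 1⟩ with hζ
  have hn : ‖ζ‖ = N.trueDist w := by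
    rw [← distFun_truePos, distFun_eq, Complex.norm_eq_sqrt_sq_add_sq]
    simp only [nodeCoord_truePos]
    rfl
  rw [← hn, angle]
  fin_cases r
  · exact Complex.norm_mul_cos_arg ζ
  · exact Complex.norm_mul_sin_arg ζ

/-- The sign with which the position of an agent enters the distance of a link. -/
noncomputable def linkSign (w : Fin Na × (Fin Na ⊕ Fin Nb)) (m : Fin Na) : ℝ :=
  (if m = w.1 then 1 else 0) - (if Sum.inl m = w.2 then 1 else 0)

/-- The gradient of the distance of a link in the coordinates of the agents. -/
noncomputable def distGrad (w : N.Link) (a : Fin Na × Fin 2) : ℝ :=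
  linkSign w.1 a.1 * unitVec (N.angle w.1.1 w.1.2) a.2

/-- The gradient of `‖p_k - p_j‖` is `(p_k - p_j) / d = q` in `p_k` and `-q` in `p_j`; an anchor is
not a parameter and contributes nothing. -/
lemma fderiv_distFun_single (w : N.Link) (a : Fin Na × Fin 2) :
    fderiv ℝ (N.distFun w) N.truePos (Pi.single a 1) = N.distGrad w a := by
  have h1 : ∀ r, HasFDerivAt (fun x : Fin Na × Fin 2 → ℝ =>
      x (w.1.1, r) - (nodeCoord w.1.2 r x + N.nodeConst w.1.2 r))
      (ContinuousLinearMap.proj (R := ℝ) (φ := fun _ => ℝ) (w.1.1, r) - nodeCoord w.1.2 r)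
      N.truePos := fun r =>
    (ContinuousLinearMap.proj (R := ℝ) (φ := fun _ => ℝ) (w.1.1, r)).hasFDerivAt.sub
      ((nodeCoord w.1.2 r).hasFDerivAt.add_const _)
  have h2 := (((h1 0).pow 2).add ((h1 1).pow 2)).sqrt (by
    simp only [Pi.add_apply, nodeCoord_truePos]
    exact (N.sq_sum_pos w).ne')
  have h3 : N.distFun w = fun x => _ := funext (N.distFun_eq w)
  have h4 := h2.fderiv
  have hd : Real.sqrt ((N.agentPos w.1.1 0 - N.pos N.agentPos w.1.2 0) ^ 2 +
      (N.agentPos w.1.1 1 - N.pos N.agentPos w.1.2 1) ^ 2) = N.trueDist w := by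
    rw [← distFun_truePos, distFun_eq]
    simp only [nodeCoord_truePos]
    rfl
  have hv : ∀ r, (ContinuousLinearMap.proj (R := ℝ) (φ := fun _ => ℝ) (w.1.1, r) -
      nodeCoord w.1.2 r) (Pi.single a 1) = if r = a.2 then linkSign w.1 a.1 else 0 := by
    intro r
    obtain ⟨⟨k, j⟩, hw⟩ := w
    obtain ⟨m, r'⟩ := a
    cases j <;> by_cases hr : r = r' <;>
      simp [nodeCoord, linkSign, Pi.single_apply, hr, eq_comm]
  rw [h3]
  refine (DFunLike.congr_fun h4 _).trans ?_
  simp only [Pi.add_apply, nodeCoord_truePos, _root_.smul_apply, _root_.add_apply, hv]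
  have hpos := N.trueDist_pos w
  have e0 := N.trueDist_mul_unitVec w 0
  have e1 := N.trueDist_mul_unitVec w 1
  simp only [truePos]
  rw [hd, ← e0, ← e1, distGrad]
  obtain ⟨m, r'⟩ := a
  fin_cases r' <;> simp <;> field_simp

end Network

/-! ### The Fisher information matrix as a sum over links. -/

namespace Network

variable {Na Nb : ℕ} (N : Network Na Nb)

/-- The position coordinates of a parameter vector. -/
def posPart : (N.Param → ℝ) →L[ℝ] (Fin Na × Fin 2 → ℝ) :=
  ContinuousLinearMap.pi fun a => ContinuousLinearMap.proj (Sum.inl a)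

/-- The channel vector of a link in a parameter vector. -/
def chanPart (w : N.Link) : (N.Param → ℝ) →L[ℝ] (Chan (N.paths w) → ℝ) :=
  ContinuousLinearMap.pi fun i => ContinuousLinearMap.proj (Sum.inr ⟨w, i⟩)

/-- The distance and the channel of a link as functions of the parameter vector. -/
noncomputable def linkPair (w : N.Link) (θ : N.Param → ℝ) : ℝ × (Chan (N.paths w) → ℝ) :=
  (N.distFun w (N.posPart θ), N.chanPart w θ)

/-- Delays and scaled amplitudes as a linear function of distance and channel. -/
noncomputable def delayAmpLin (w : N.Link) :
    ℝ × (Chan (N.paths w) → ℝ) →L[ℝ] (Chan (N.paths w) → ℝ) :=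
  N.c⁻¹ • ((ContinuousLinearMap.fst ℝ ℝ _).smulRight (delayVec (L := N.paths w)) +
    ContinuousLinearMap.snd ℝ ℝ _)

lemma delayAmpLin_apply (w : N.Link) (y : ℝ × (Chan (N.paths w) → ℝ)) :
    N.delayAmpLin w y = delayAmp N.c y.1 y.2 := by
  ext i
  cases i <;> simp [delayAmpLin, delayAmp, delayVec] <;> ring

/-- The log-density of a link as a function of its distance and its channel. -/
noncomputable def linkLogDensity {Ω : Type*} (B : N.Link → ℝ≥0 → Ω → ℝ) (z : N.Channels × Ω)
    (w : N.Link) (y : ℝ × (Chan (N.paths w) → ℝ)) : ℝ :=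
  N.linkLogLik B z w (N.delayAmpLin w y) + N.logPrior w y

lemma linkPair_trueParam (κ : N.Channels) (w : N.Link) :
    N.linkPair w (N.trueParam κ) = (N.trueDist w, κ w) := by
  refine Prod.ext ?_ rfl
  exact N.distFun_truePos w

lemma delayAmpLin_true (κ : N.Channels) (w : N.Link) :
    N.delayAmpLin w (N.trueDist w, κ w) = N.trueDelayAmp κ w :=
  N.delayAmpLin_apply w _

lemma contDiffAt_linkPair (κ : N.Channels) (w : N.Link) :
    ContDiffAt ℝ 2 (N.linkPair w) (N.trueParam κ) :=
  ((N.contDiffAt_distFun w).comp (N.trueParam κ) N.posPart.contDiff.contDiffAt).prodMk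
    (N.chanPart w).contDiff.contDiffAt

lemma fderiv_linkPair {w : N.Link} {θ : N.Param → ℝ}
    (h : DifferentiableAt ℝ (N.distFun w) (N.posPart θ)) (v : N.Param → ℝ) :
    fderiv ℝ (N.linkPair w) θ v =
      (fderiv ℝ (N.distFun w) (N.posPart θ) (N.posPart v), N.chanPart w v) := by
  have h1 := (h.hasFDerivAt.comp θ N.posPart.hasFDerivAt).prodMk (N.chanPart w).hasFDerivAt (x := θ)
  have h2 : fderiv ℝ (N.linkPair w) θ = _ := h1.fderiv
  rw [h2]; rfl

/-- The channel is a linear function of the parameters, so only the distance contributes curvature.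
-/
lemma fderiv_fderiv_linkPair (κ : N.Channels) (w : N.Link) (u v : N.Param → ℝ) :
    fderiv ℝ (fderiv ℝ (N.linkPair w)) (N.trueParam κ) u v =
      (fderiv ℝ (fderiv ℝ (N.distFun w)) N.truePos (N.posPart u) (N.posPart v), 0) := by
  have hc := N.contDiffAt_distFun w
  have d1 : DifferentiableAt ℝ (fderiv ℝ (N.linkPair w)) (N.trueParam κ) :=
    ((N.contDiffAt_linkPair κ w).fderiv_right (m := 1) (by norm_num)).differentiableAt one_ne_zero
  have d2 : DifferentiableAt ℝ (fderiv ℝ (N.distFun w)) N.truePos :=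
    (hc.fderiv_right (m := 1) (by norm_num)).differentiableAt one_ne_zero
  have h1 : (fun θ => fderiv ℝ (N.linkPair w) θ v) =ᶠ[𝓝 (N.trueParam κ)]
      fun θ => (fderiv ℝ (N.distFun w) (N.posPart θ) (N.posPart v), N.chanPart w v) := by
    have hev : ∀ᶠ θ in 𝓝 (N.trueParam κ),
        ContDiffAt ℝ 2 (N.distFun w) (N.posPart θ) :=
      (N.posPart.continuous.tendsto (N.trueParam κ)).eventually (hc.eventually (by simp))
    filter_upwards [hev] with θ hθ
    exact N.fderiv_linkPair (hθ.differentiableAt two_ne_zero) v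
  have h2 := (d1.hasFDerivAt.clm_apply (hasFDerivAt_const v (N.trueParam κ))).fderiv
  have h3 := ((d2.hasFDerivAt.comp (N.trueParam κ) N.posPart.hasFDerivAt).clm_apply
    (hasFDerivAt_const (N.posPart v) (N.trueParam κ))).prodMk
    (hasFDerivAt_const (𝕜 := ℝ) (N.chanPart w v) (N.trueParam κ))
  have h4 := h1.fderiv_eq (𝕜 := ℝ)
  rw [h2] at h4
  have h5 := DFunLike.congr_fun (h4.trans h3.fderiv) u
  simpa using h5

section Observation

variable {Ω : Type*} [MeasurableSpace Ω] {Pr : Measure Ω} [IsProbabilityMeasure Pr]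
  {B : N.Link → ℝ≥0 → Ω → ℝ}

/-- Almost surely all noise paths are continuous and all priors are regular at the channels. -/
lemma ae_regular (hB : N.IsNoise Pr B) (hprior : ∀ w, N.PriorRegular w) :
    ∀ᵐ z ∂(N.jointLaw Pr), ∀ w, Continuous (fun t => B w t z.2) ∧
      0 < N.chanDensity w (N.trueDist w) (z.1 w) ∧
      ContDiffAt ℝ 2 (fun y : ℝ × (Chan (N.paths w) → ℝ) => N.chanDensity w y.1 y.2)
        (N.trueDist w, z.1 w) := by
  have h : ∀ᵐ z ∂(N.jointLaw Pr), ∀ w, 0 < N.chanDensity w (N.trueDist w) (z.1 w) ∧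
      ContDiffAt ℝ 2 (fun y : ℝ × (Chan (N.paths w) → ℝ) => N.chanDensity w y.1 y.2)
        (N.trueDist w, z.1 w) :=
    ae_all_iff.2 fun w => (N.measurePreserving_channel w).quasiMeasurePreserving.ae
      (N.ae_chanLaw_regular w (hprior w))
  filter_upwards [N.ae_continuous_path hB, h] with z h1 h2 w
  exact ⟨h1 w, h2 w⟩

omit [MeasurableSpace Ω] in
lemma contDiffAt_linkLogDensity (hs : ContDiff ℝ 3 N.s) {z : N.Channels × Ω} {w : N.Link}
    (h1 : Continuous fun t => B w t z.2)
    (h2 : ContDiffAt ℝ 2 (N.logPrior w) (N.trueDist w, z.1 w)) :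
    ContDiffAt ℝ 2 (N.linkLogDensity B z w) (N.trueDist w, z.1 w) :=
  ((N.contDiff_linkLogLik hs h1).comp (N.delayAmpLin w).contDiff).contDiffAt.add h2

-- The last summand isolates the curvature of the distance times the total score in the distance,
-- the part that vanishes in mean.
omit [MeasurableSpace Ω] in
lemma secondPartial_log_jointDensity (hs : ContDiff ℝ 3 N.s) {z : N.Channels × Ω}
    (hz : ∀ w, Continuous (fun t => B w t z.2) ∧
      0 < N.chanDensity w (N.trueDist w) (z.1 w) ∧
      ContDiffAt ℝ 2 (fun y : ℝ × (Chan (N.paths w) → ℝ) => N.chanDensity w y.1 y.2)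
        (N.trueDist w, z.1 w)) (u v : N.Param → ℝ) :
    secondPartial (fun θ => Real.log (N.jointDensity (N.obs B z) θ)) (N.trueParam z.1) u v =
      ∑ w, (secondPartial (N.linkLogLik B z w) (N.trueDelayAmp z.1 w)
          (N.delayAmpLin w (fderiv ℝ (N.linkPair w) (N.trueParam z.1) u))
          (N.delayAmpLin w (fderiv ℝ (N.linkPair w) (N.trueParam z.1) v)) +
        secondPartial (N.logPrior w) (N.trueDist w, z.1 w)
          (fderiv ℝ (N.linkPair w) (N.trueParam z.1) u)
          (fderiv ℝ (N.linkPair w) (N.trueParam z.1) v) +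
        fderiv ℝ (fderiv ℝ (N.distFun w)) N.truePos (N.posPart u) (N.posPart v) *
          (fderiv ℝ (N.linkLogLik B z w) (N.trueDelayAmp z.1 w) (N.delayAmpLin w (1, 0)) +
          fderiv ℝ (N.logPrior w) (N.trueDist w, z.1 w) (1, 0))) := by
  have hlp : ∀ w, ContDiffAt ℝ 2 (N.logPrior w) (N.trueDist w, z.1 w) := fun w =>
    (hz w).2.2.log (hz w).2.1.ne'
  have hld := fun w => N.contDiffAt_linkLogDensity hs (hz w).1 (hlp w)
  have hev : (fun θ => Real.log (N.jointDensity (N.obs B z) θ)) =ᶠ[𝓝 (N.trueParam z.1)]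
      fun θ => ∑ w, N.linkLogDensity B z w (N.linkPair w θ) := by
    -- The logarithm of the product splits only where no density vanishes; continuity provides a
    -- neighbourhood of the true parameter where this holds.
    have h1 : ∀ᶠ θ in 𝓝 (N.trueParam z.1), ∀ w,
        N.chanDensity w (N.linkPair w θ).1 (N.linkPair w θ).2 ≠ 0 := by
      refine eventually_all.2 fun w => ?_
      have h2 : ∀ᶠ y in 𝓝 (N.linkPair w (N.trueParam z.1)), N.chanDensity w y.1 y.2 ≠ 0 := by
        rw [linkPair_trueParam]
        exact (hz w).2.2.continuousAt.eventually_ne (hz w).2.1.ne'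
      exact (N.contDiffAt_linkPair z.1 w).continuousAt.eventually h2
    filter_upwards [h1] with θ hθ
    rw [jointDensity, Real.log_prod]
    · refine Finset.sum_congr rfl fun w _ => ?_
      refine (Real.log_mul (Real.exp_pos _).ne' (hθ w)).trans ?_
      rw [linkLogDensity, delayAmpLin_apply]
      rfl
    · exact fun w _ => mul_ne_zero (Real.exp_pos _).ne' (hθ w)
  have hld' : ∀ w, ContDiffAt ℝ 2 (N.linkLogDensity B z w) (N.linkPair w (N.trueParam z.1)) :=
    fun w => by rw [linkPair_trueParam]; exact hld w
  rw [secondPartial_congr hev, secondPartial_sum (f := fun w θ => N.linkLogDensity B z w (N.linkPair w θ)) _ fun w _ =>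
    (hld' w).comp _ (N.contDiffAt_linkPair z.1 w)]
  refine Finset.sum_congr rfl fun w _ => ?_
  have hll := N.contDiff_linkLogLik hs (hz w).1
  rw [secondPartial_comp (hld' w) (N.contDiffAt_linkPair z.1 w), fderiv_fderiv_linkPair,
    linkPair_trueParam]
  have e1 : ∀ a b, secondPartial (N.linkLogDensity B z w) (N.trueDist w, z.1 w) a b =
      secondPartial (N.linkLogLik B z w) (N.trueDelayAmp z.1 w)
        (N.delayAmpLin w a) (N.delayAmpLin w b) +
      secondPartial (N.logPrior w) (N.trueDist w, z.1 w) a b := by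
    intro a b
    have := secondPartial_add (hll.comp (N.delayAmpLin w).contDiff).contDiffAt (hlp w) a b
    refine this.trans ?_
    rw [← delayAmpLin_true, ← secondPartial_comp_clm _ hll.contDiffAt]
    rfl
  have e2 : ∀ r : ℝ, fderiv ℝ (N.linkLogDensity B z w) (N.trueDist w, z.1 w) (r, 0) =
      r * (fderiv ℝ (N.linkLogLik B z w) (N.trueDelayAmp z.1 w) (N.delayAmpLin w (1, 0)) +
          fderiv ℝ (N.logPrior w) (N.trueDist w, z.1 w) (1, 0)) := by
    intro r
    have d1 : HasFDerivAt (N.linkLogLik B z w) _ (N.delayAmpLin w (N.trueDist w, z.1 w)) :=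
      (hll.differentiable two_ne_zero _).hasFDerivAt
    have d2 := (d1.comp (N.trueDist w, z.1 w) (N.delayAmpLin w).hasFDerivAt).add
      ((hlp w).differentiableAt two_ne_zero).hasFDerivAt
    have d3 : fderiv ℝ (N.linkLogDensity B z w) (N.trueDist w, z.1 w) = _ := d2.fderiv
    have hr : ((r, 0) : ℝ × (Chan (N.paths w) → ℝ)) = r • (1, 0) := by simp
    rw [hr, map_smul, d3, delayAmpLin_true]
    rfl
  rw [e1, e2]

/-- The directional derivatives of the log-likelihood of a waveform have mean zero. -/
lemma integral_fderiv_linkLogLik (hB : N.IsNoise Pr B) (hs : ContDiff ℝ 3 N.s)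
    (hinfo : N.FiniteInfo Pr B) (w : N.Link) (v : Chan (N.paths w) → ℝ) :
    Integrable (fun z => fderiv ℝ (N.linkLogLik B z w) (N.trueDelayAmp z.1 w) v) (N.jointLaw Pr) ∧
      ∫ z, fderiv ℝ (N.linkLogLik B z w) (N.trueDelayAmp z.1 w) v ∂(N.jointLaw Pr) = 0 := by
  have he : (fun z => fderiv ℝ (N.linkLogLik B z w) (N.trueDelayAmp z.1 w) v) =ᵐ[N.jointLaw Pr]
      fun z => ∑ i, v i * lineDeriv ℝ (N.linkLogLik B z w) (N.trueDelayAmp z.1 w)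
        (Pi.single i 1) := by
    filter_upwards [N.ae_continuous_path hB] with z hz
    have hd := (N.contDiff_linkLogLik hs (hz w)).differentiable two_ne_zero
      (N.trueDelayAmp z.1 w)
    conv_lhs => rw [pi_eq_sum_single v]
    simp only [map_sum, map_smul, smul_eq_mul, hd.lineDeriv_eq_fderiv]
  have hi : ∀ i ∈ Finset.univ, Integrable (fun z => v i *
      lineDeriv ℝ (N.linkLogLik B z w) (N.trueDelayAmp z.1 w) (Pi.single i 1)) (N.jointLaw Pr) :=
    fun i _ => (hinfo.score w i).const_mul _
  refine ⟨(integrable_finsetSum _ hi).congr he.symm, ?_⟩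
  rw [integral_congr_ae he, integral_finsetSum _ hi]
  refine Finset.sum_eq_zero fun i _ => ?_
  rw [integral_const_mul, N.integral_score hB hs w _ (hinfo.score w i), mul_zero]

/-- The Fisher information of a link about its distance and channel, as a bilinear form. -/
noncomputable def linkInfo (Pr : Measure Ω) (B : N.Link → ℝ≥0 → Ω → ℝ) (w : N.Link)
    (a b : ℝ × (Chan (N.paths w) → ℝ)) : ℝ :=
  N.delayAmpLin w a ⬝ᵥ (N.Psi Pr B w *ᵥ N.delayAmpLin w b) +
    pairCoeff a ⬝ᵥ (N.Xi w *ᵥ pairCoeff b)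

/-- The direction in which a parameter moves the distance and the channel of a link. -/
noncomputable def paramDir (w : N.Link) (i : N.Param) : ℝ × (Chan (N.paths w) → ℝ) :=
  (fderiv ℝ (N.distFun w) N.truePos (N.posPart (Pi.single i 1)), N.chanPart w (Pi.single i 1))

/-- The curvature `H` is deterministic and multiplies two scores of mean zero. The directions
`paramDir` do not depend on the channels, so they come out of the expectation. -/
lemma fim_apply (hB : N.IsNoise Pr B) (hs : ContDiff ℝ 3 N.s)
    (hprior : ∀ w, N.PriorRegular w) (hinfo : N.FiniteInfo Pr B) (i j : N.Param) :
    N.fim Pr B i j = ∑ w, N.linkInfo Pr B w (N.paramDir w i) (N.paramDir w j) := by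
  have hdir : ∀ (κ : N.Channels) (w : N.Link) (i : N.Param),
      fderiv ℝ (N.linkPair w) (N.trueParam κ) (Pi.single i 1) = N.paramDir w i := by
    intro κ w i
    exact N.fderiv_linkPair ((N.contDiffAt_distFun w).differentiableAt two_ne_zero) _
  set H : N.Link → ℝ := fun w => fderiv ℝ (fderiv ℝ (N.distFun w)) N.truePos
    (N.posPart (Pi.single i 1)) (N.posPart (Pi.single j 1))
  have he : (fun z => -secondPartial (fun θ => Real.log (N.jointDensity (N.obs B z) θ))
      (N.trueParam z.1) (Pi.single i 1) (Pi.single j 1)) =ᵐ[N.jointLaw Pr]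
      fun z => ∑ w, (-secondPartial (N.linkLogLik B z w) (N.trueDelayAmp z.1 w)
          (N.delayAmpLin w (N.paramDir w i)) (N.delayAmpLin w (N.paramDir w j)) +
        (-secondPartial (N.logPrior w) (N.trueDist w, z.1 w) (N.paramDir w i) (N.paramDir w j) +
        (-H w * fderiv ℝ (N.linkLogLik B z w) (N.trueDelayAmp z.1 w) (N.delayAmpLin w (1, 0)) +
          -H w * fderiv ℝ (N.logPrior w) (N.trueDist w, z.1 w) (1, 0)))) := by
    filter_upwards [N.ae_regular hB hprior] with z hz
    rw [N.secondPartial_log_jointDensity hs hz, ← Finset.sum_neg_distrib]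
    refine Finset.sum_congr rfl fun w _ => ?_
    simp only [hdir, H]
    ring
  have i1 := fun w => N.integral_linkLogLik_bilin hB hs hinfo w
    (N.delayAmpLin w (N.paramDir w i)) (N.delayAmpLin w (N.paramDir w j))
  have i2 := fun w => N.integral_logPrior_bilin hprior hinfo w (N.paramDir w i) (N.paramDir w j)
  have i3 := fun w => N.integral_fderiv_linkLogLik hB hs hinfo w (N.delayAmpLin w (1, 0))
  have i4 := fun w => N.integral_prior_score w (hprior w)
  have j1 := fun w => (i1 w).1.fun_neg
  have j2 := fun w => N.integrable_comp_channel (Pr := Pr) w (i2 w).1.fun_neg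
  have j3 := fun w => (i3 w).1.const_mul (-H w)
  have j4 := fun w => N.integrable_comp_channel (Pr := Pr) w ((i4 w).1.const_mul (-H w))
  rw [fim, Matrix.of_apply, integral_congr_ae he, integral_finsetSum _ fun w _ =>
    (j1 w).fun_add ((j2 w).fun_add ((j3 w).fun_add (j4 w)))]
  refine Finset.sum_congr rfl fun w _ => ?_
  rw [integral_add (j1 w) ((j2 w).fun_add ((j3 w).fun_add (j4 w))),
    integral_add (j2 w) ((j3 w).fun_add (j4 w)), integral_add (j3 w) (j4 w), (i1 w).2,
    N.integral_comp_channel w (i2 w).1.fun_neg, (i2 w).2, integral_const_mul, (i3 w).2,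
    N.integral_comp_channel w ((i4 w).1.const_mul (-H w)), integral_const_mul, (i4 w).2, linkInfo]
  ring

end Observation

end Network

/-! ### Inverses and congruences of block diagonal matrices. -/

section Blocks

variable {o : Type*} [Fintype o] [DecidableEq o] {m' : o → Type*} [∀ i, Fintype (m' i)]
  [∀ i, DecidableEq (m' i)]

/-- The diagonal block of the inverse is a right inverse of `d k`, as the `(k, k)` block of the
identity shows. -/
lemma isUnit_det_of_isUnit_det_blockDiagonal' {d : ∀ i, Matrix (m' i) (m' i) ℝ}
    (h : IsUnit (Matrix.blockDiagonal' d).det) (k : o) : IsUnit (d k).det := by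
  have h1 := Matrix.mul_nonsing_inv _ h
  have h2 : d k * ((Matrix.blockDiagonal' d)⁻¹).submatrix (Sigma.mk k) (Sigma.mk k) = 1 := by
    ext i j
    have h3 := congrFun (congrFun h1 ⟨k, i⟩) ⟨k, j⟩
    rw [Matrix.mul_apply, Fintype.sum_sigma] at h3
    rw [Finset.sum_eq_single k] at h3
    · simp only [Matrix.blockDiagonal'_apply_eq] at h3
      rw [Matrix.mul_apply]
      simp only [Matrix.submatrix_apply, h3, Matrix.one_apply, Sigma.mk.injEq, heq_eq_eq,
        true_and]
    · intro b _ hb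
      refine Finset.sum_eq_zero fun x _ => ?_
      rw [Matrix.blockDiagonal'_apply_ne _ _ _ hb.symm, zero_mul]
    · simp
  exact Matrix.isUnit_det_of_right_inverse h2

lemma blockDiagonal'_nonsing_inv {d : ∀ i, Matrix (m' i) (m' i) ℝ}
    (h : ∀ k, IsUnit (d k).det) :
    (Matrix.blockDiagonal' d)⁻¹ = Matrix.blockDiagonal' fun k => (d k)⁻¹ := by
  refine Matrix.inv_eq_right_inv ?_
  rw [← Matrix.blockDiagonal'_mul]
  have : (fun k => d k * (d k)⁻¹) = 1 := by
    ext1 k; exact Matrix.mul_nonsing_inv _ (h k)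
  rw [this, Matrix.blockDiagonal'_one]

-- The shape of the Schur correction: a cross block that is rank one on each link turns it into a
-- sum of quadratic forms, one per link.
omit [∀ i, DecidableEq (m' i)] in
lemma mul_blockDiagonal'_mul_transpose_apply {ι : Type*} (e : ∀ i, Matrix (m' i) (m' i) ℝ)
    (g : o → ι → ℝ) (β : ∀ i, m' i → ℝ) (a b : ι) :
    ((Matrix.of fun a (x : Σ i, m' i) => g x.1 a * β x.1 x.2) * Matrix.blockDiagonal' e *
      (Matrix.of fun a (x : Σ i, m' i) => g x.1 a * β x.1 x.2)ᵀ) a b =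
      ∑ k, g k a * g k b * (β k ⬝ᵥ (e k *ᵥ β k)) := by
  rw [Matrix.mul_assoc, Matrix.mul_apply, Fintype.sum_sigma]
  refine Finset.sum_congr rfl fun k _ => ?_
  simp only [dotProduct, Finset.mul_sum]
  refine Finset.sum_congr rfl fun i _ => ?_
  rw [Matrix.mul_apply, Fintype.sum_sigma, Finset.sum_eq_single k]
  · simp only [Matrix.of_apply, Matrix.blockDiagonal'_apply_eq, Matrix.transpose_apply,
      Matrix.mulVec, dotProduct, Finset.mul_sum]
    exact Finset.sum_congr rfl fun j _ => by ring
  · intro k' _ hk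
    refine Finset.sum_eq_zero fun x _ => ?_
    rw [Matrix.blockDiagonal'_apply_ne _ _ _ hk.symm, zero_mul]
  · simp

end Blocks

/-! ### The blocks of the Fisher matrix and the Schur complement. -/

namespace Network

variable {Na Nb : ℕ} (N : Network Na Nb)

lemma posPart_single_inl (a : Fin Na × Fin 2) :
    N.posPart (Pi.single (Sum.inl a) 1) = Pi.single a 1 := by
  ext b; simp [posPart, Pi.single_apply]

lemma posPart_single_inr (i : Σ w : N.Link, Chan (N.paths w)) :
    N.posPart (Pi.single (Sum.inr i) 1) = 0 := by
  ext b; simp [posPart]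

lemma chanPart_single_inl (w : N.Link) (a : Fin Na × Fin 2) :
    N.chanPart w (Pi.single (Sum.inl a) 1) = 0 := by
  ext b; simp [chanPart]

lemma chanPart_single_inr (w : N.Link) (i : Chan (N.paths w)) :
    N.chanPart w (Pi.single (Sum.inr ⟨w, i⟩) 1) = Pi.single i 1 := by
  ext b; simp [chanPart, Pi.single_apply]

lemma chanPart_single_inr_of_ne {w w' : N.Link} (h : w ≠ w') (i : Chan (N.paths w')) :
    N.chanPart w (Pi.single (Sum.inr ⟨w', i⟩) 1) = 0 := by
  ext b; simp [chanPart, h]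

/-- Positions move only distances, and a channel parameter moves only its own link (the next two
lemmas); this decouples the links. -/
lemma paramDir_inl (w : N.Link) (a : Fin Na × Fin 2) :
    N.paramDir w (Sum.inl a) = N.distGrad w a • (1, 0) := by
  rw [paramDir, posPart_single_inl, fderiv_distFun_single, chanPart_single_inl]
  simp

lemma paramDir_inr (w : N.Link) (i : Chan (N.paths w)) :
    N.paramDir w (Sum.inr ⟨w, i⟩) = (0, Pi.single i 1) := by
  rw [paramDir, posPart_single_inr, chanPart_single_inr, map_zero]

lemma paramDir_inr_of_ne {w w' : N.Link} (h : w ≠ w') (i : Chan (N.paths w')) :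
    N.paramDir w (Sum.inr ⟨w', i⟩) = 0 := by
  rw [paramDir, posPart_single_inr, chanPart_single_inr_of_ne _ h, map_zero]; rfl

section Observation

variable {Ω : Type*} [MeasurableSpace Ω] {Pr : Measure Ω}
  {B : N.Link → ℝ≥0 → Ω → ℝ}

lemma pairCoeff_smul {ι : Type*} (r : ℝ) (y : ℝ × (ι → ℝ)) :
    pairCoeff (r • y) = r • pairCoeff y := by
  ext i; cases i <;> simp [pairCoeff]

lemma pairCoeff_add {ι : Type*} (x y : ℝ × (ι → ℝ)) :
    pairCoeff (x + y) = pairCoeff x + pairCoeff y := by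
  ext i; cases i <;> simp [pairCoeff]

lemma linkInfo_smul_left (w : N.Link) (r : ℝ) (a b : ℝ × (Chan (N.paths w) → ℝ)) :
    N.linkInfo Pr B w (r • a) b = r * N.linkInfo Pr B w a b := by
  simp only [linkInfo, map_smul, pairCoeff_smul, smul_dotProduct, smul_eq_mul]; ring

lemma linkInfo_smul_right (w : N.Link) (r : ℝ) (a b : ℝ × (Chan (N.paths w) → ℝ)) :
    N.linkInfo Pr B w a (r • b) = r * N.linkInfo Pr B w a b := by
  simp only [linkInfo, map_smul, pairCoeff_smul, Matrix.mulVec_smul, dotProduct_smul,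
    smul_eq_mul]; ring

lemma linkInfo_add_left (w : N.Link) (a a' b : ℝ × (Chan (N.paths w) → ℝ)) :
    N.linkInfo Pr B w (a + a') b = N.linkInfo Pr B w a b + N.linkInfo Pr B w a' b := by
  simp only [linkInfo, map_add, pairCoeff_add, add_dotProduct]; ring

lemma linkInfo_add_right (w : N.Link) (a b b' : ℝ × (Chan (N.paths w) → ℝ)) :
    N.linkInfo Pr B w a (b + b') = N.linkInfo Pr B w a b + N.linkInfo Pr B w a b' := by
  simp only [linkInfo, map_add, pairCoeff_add, Matrix.mulVec_add, dotProduct_add]; ring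

lemma linkInfo_zero_left (w : N.Link) (b : ℝ × (Chan (N.paths w) → ℝ)) :
    N.linkInfo Pr B w 0 b = 0 := by
  simpa using N.linkInfo_smul_left (Pr := Pr) (B := B) w 0 0 b

lemma linkInfo_zero_right (w : N.Link) (a : ℝ × (Chan (N.paths w) → ℝ)) :
    N.linkInfo Pr B w a 0 = 0 := by
  simpa using N.linkInfo_smul_right (Pr := Pr) (B := B) w 0 a 0

lemma delayAmpLin_dist (w : N.Link) : N.delayAmpLin w (1, 0) = N.c⁻¹ • delayVec := by
  simp [delayAmpLin]

lemma delayAmpLin_chan (w : N.Link) (x : Chan (N.paths w) → ℝ) :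
    N.delayAmpLin w (0, x) = N.c⁻¹ • x := by
  simp [delayAmpLin]

/-- This and the next two evaluations recover the ingredients of `λ`. Delays and scaled amplitudes
carry a factor `1 / c`, so pulling out `1 / c ^ 2` leaves `c ^ 2` in front of `Ξ`. -/
lemma linkInfo_dist_dist (w : N.Link) :
    N.linkInfo Pr B w (1, 0) (1, 0) =
      1 / N.c ^ 2 * (delayVec ⬝ᵥ (N.Psi Pr B w *ᵥ delayVec) + N.c ^ 2 * N.Xi w none none) := by
  have hc := N.c_pos.ne'
  rw [linkInfo, delayAmpLin_dist]
  have h1 : pairCoeff ((1, 0) : ℝ × (Chan (N.paths w) → ℝ)) ⬝ᵥ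
      (N.Xi w *ᵥ pairCoeff (1, 0)) = N.Xi w none none := by
    simp [pairCoeff, dotProduct, Matrix.mulVec, Fintype.sum_option]
  rw [h1, smul_dotProduct, Matrix.mulVec_smul, dotProduct_smul, smul_eq_mul, smul_eq_mul]
  field_simp

lemma linkInfo_dist_chan (w : N.Link) (x : Chan (N.paths w) → ℝ) :
    N.linkInfo Pr B w (1, 0) (0, x) = 1 / N.c ^ 2 * (N.crossInfo Pr B w ⬝ᵥ x) := by
  have hc := N.c_pos.ne'
  rw [linkInfo, delayAmpLin_dist, delayAmpLin_chan]
  have h1 : pairCoeff ((1, 0) : ℝ × (Chan (N.paths w) → ℝ)) ⬝ᵥ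
      (N.Xi w *ᵥ pairCoeff (0, x)) = (fun i => N.Xi w none (some i)) ⬝ᵥ x := by
    simp [pairCoeff, dotProduct, Matrix.mulVec, Fintype.sum_option]
  rw [h1, smul_dotProduct, Matrix.mulVec_smul, dotProduct_smul, smul_eq_mul, smul_eq_mul,
    crossInfo, add_dotProduct, smul_dotProduct, Matrix.dotProduct_mulVec, smul_eq_mul]
  field_simp

lemma linkInfo_chan_chan (w : N.Link) (x y : Chan (N.paths w) → ℝ) :
    N.linkInfo Pr B w (0, x) (0, y) = 1 / N.c ^ 2 * (x ⬝ᵥ (N.chanInfo Pr B w *ᵥ y)) := by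
  have hc := N.c_pos.ne'
  rw [linkInfo, delayAmpLin_chan, delayAmpLin_chan]
  have h1 : pairCoeff ((0, x) : ℝ × (Chan (N.paths w) → ℝ)) ⬝ᵥ
      (N.Xi w *ᵥ pairCoeff (0, y)) = x ⬝ᵥ ((N.Xi w).submatrix some some *ᵥ y) := by
    simp [pairCoeff, dotProduct, Matrix.mulVec, Fintype.sum_option]
  rw [h1, smul_dotProduct, Matrix.mulVec_smul, dotProduct_smul, smul_eq_mul, smul_eq_mul,
    chanInfo, Matrix.add_mulVec, dotProduct_add, Matrix.smul_mulVec, dotProduct_smul, smul_eq_mul]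
  field_simp

variable [IsProbabilityMeasure Pr]

lemma fim_toBlocks₂₂ (hB : N.IsNoise Pr B) (hs : ContDiff ℝ 3 N.s)
    (hprior : ∀ w, N.PriorRegular w) (hinfo : N.FiniteInfo Pr B) :
    (N.fim Pr B).toBlocks₂₂ =
      Matrix.blockDiagonal' fun w => (1 / N.c ^ 2) • N.chanInfo Pr B w := by
  ext ⟨w, i⟩ ⟨w', j⟩
  simp only [Matrix.toBlocks₂₂, Matrix.of_apply]
  rw [N.fim_apply hB hs hprior hinfo]
  rw [Finset.sum_eq_single w]
  · rw [paramDir_inr]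
    by_cases h : w = w'
    · subst h
      rw [paramDir_inr, linkInfo_chan_chan, Matrix.blockDiagonal'_apply_eq]
      simp
    · rw [N.paramDir_inr_of_ne h, linkInfo_zero_right, Matrix.blockDiagonal'_apply_ne _ _ _ h]
  · intro b _ hb
    rw [N.paramDir_inr_of_ne hb, linkInfo_zero_left]
  · simp

lemma fim_toBlocks₁₂ (hB : N.IsNoise Pr B) (hs : ContDiff ℝ 3 N.s)
    (hprior : ∀ w, N.PriorRegular w) (hinfo : N.FiniteInfo Pr B) :
    (N.fim Pr B).toBlocks₁₂ = Matrix.of fun a (x : Σ w : N.Link, Chan (N.paths w)) =>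
      N.distGrad x.1 a * (1 / N.c ^ 2 * N.crossInfo Pr B x.1 x.2) := by
  ext a ⟨w, i⟩
  simp only [Matrix.toBlocks₁₂, Matrix.of_apply]
  rw [N.fim_apply hB hs hprior hinfo, Finset.sum_eq_single w]
  · rw [paramDir_inr, paramDir_inl, linkInfo_smul_left, linkInfo_dist_chan]
    simp
  · intro b _ hb
    rw [N.paramDir_inr_of_ne hb, linkInfo_zero_right]
  · simp

lemma isUnit_det_chanInfo (hB : N.IsNoise Pr B) (hs : ContDiff ℝ 3 N.s)
    (hprior : ∀ w, N.PriorRegular w) (hinfo : N.FiniteInfo Pr B)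
    (hC : IsUnit ((N.fim Pr B).toBlocks₂₂).det) (w : N.Link) :
    IsUnit (N.chanInfo Pr B w).det := by
  rw [N.fim_toBlocks₂₂ hB hs hprior hinfo] at hC
  have h := isUnit_det_of_isUnit_det_blockDiagonal' hC w
  rw [Matrix.det_smul] at h
  exact isUnit_of_mul_isUnit_right h

/-- The equivalent Fisher information is a sum of one-dimensional contributions of the links. -/
lemma efim_apply (hB : N.IsNoise Pr B) (hs : ContDiff ℝ 3 N.s)
    (hprior : ∀ w, N.PriorRegular w) (hinfo : N.FiniteInfo Pr B)
    (hC : IsUnit ((N.fim Pr B).toBlocks₂₂).det) (a b : Fin Na × Fin 2) :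
    N.efim Pr B a b = ∑ w, N.distGrad w a * N.distGrad w b * N.linkRII Pr B w := by
  have hc := N.c_pos.ne'
  have hu := N.isUnit_det_chanInfo hB hs hprior hinfo hC
  have hu' : ∀ w, IsUnit ((1 / N.c ^ 2) • N.chanInfo Pr B w).det := by
    rw [N.fim_toBlocks₂₂ hB hs hprior hinfo] at hC
    exact isUnit_det_of_isUnit_det_blockDiagonal' hC
  have hinv : ∀ w, ((1 / N.c ^ 2) • N.chanInfo Pr B w)⁻¹ =
      N.c ^ 2 • (N.chanInfo Pr B w)⁻¹ := by
    intro w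
    refine Matrix.inv_eq_right_inv ?_
    rw [Matrix.smul_mul, Matrix.mul_smul, Matrix.mul_nonsing_inv _ (hu w), smul_smul,
      one_div_mul_cancel (pow_ne_zero 2 hc), one_smul]
  have h11 : (N.fim Pr B).toBlocks₁₁ a b = ∑ w, N.distGrad w a * N.distGrad w b *
      (1 / N.c ^ 2 * (delayVec ⬝ᵥ (N.Psi Pr B w *ᵥ delayVec) + N.c ^ 2 * N.Xi w none none)) := by
    simp only [Matrix.toBlocks₁₁, Matrix.of_apply]
    rw [N.fim_apply hB hs hprior hinfo]
    refine Finset.sum_congr rfl fun w _ => ?_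
    rw [paramDir_inl, paramDir_inl, linkInfo_smul_left, linkInfo_smul_right, linkInfo_dist_dist]
    ring
  rw [efim, Matrix.sub_apply, h11, N.fim_toBlocks₂₂ hB hs hprior hinfo,
    blockDiagonal'_nonsing_inv hu', N.fim_toBlocks₁₂ hB hs hprior hinfo,
    mul_blockDiagonal'_mul_transpose_apply _ (fun w => N.distGrad w)
      (fun w i => 1 / N.c ^ 2 * N.crossInfo Pr B w i), ← Finset.sum_sub_distrib]
  refine Finset.sum_congr rfl fun w _ => ?_
  have hs : (fun i => 1 / N.c ^ 2 * N.crossInfo Pr B w i) =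
      (1 / N.c ^ 2) • N.crossInfo Pr B w := rfl
  -- Two cross blocks bring `c⁻²` each and the inverse brings `c²`, so the correction carries the
  -- same `c⁻²` as the distance term.
  rw [hinv, hs, smul_dotProduct, Matrix.mulVec_smul, dotProduct_smul, Matrix.smul_mulVec,
    dotProduct_smul, linkRII]
  simp only [smul_eq_mul]
  field_simp

end Observation

/-! ### Assembling the contributions of the links into agent blocks. -/

lemma unitVec_arg_neg {ζ : ℂ} (h : ζ ≠ 0) :
    unitVec (Complex.arg (-ζ)) = -unitVec (Complex.arg ζ) := by
  ext r
  fin_cases r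
  · simp [unitVec, Complex.cos_arg h, Complex.cos_arg (neg_ne_zero.2 h), neg_div]
  · simp [unitVec, Complex.sin_arg, neg_div]

/-- Reversing a pair replaces `q` by `-q`, and `R` is quadratic in `q`. -/
lemma rdm_angle_comm (k j : Fin Na) :
    rdm (N.angle k (Sum.inl j)) = rdm (N.angle j (Sum.inl k)) := by
  set ζ : ℂ := ⟨N.agentPos k 0 - N.agentPos j 0, N.agentPos k 1 - N.agentPos j 1⟩ with hζ
  have h1 : N.angle k (Sum.inl j) = Complex.arg ζ := rfl
  have h2 : N.angle j (Sum.inl k) = Complex.arg (-ζ) := by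
    rw [angle]; congr 1
    apply Complex.ext <;> simp [hζ, pos]
  rw [h1, h2]
  -- Agents without a link between them may coincide; both angles are then `arg 0`.
  by_cases h : ζ = 0
  · rw [h, neg_zero]
  · ext r r'
    rw [rdm_apply, rdm_apply, unitVec_arg_neg h]
    simp

section Observation

variable {Ω : Type*} [MeasurableSpace Ω] {Pr : Measure Ω}
  {B : N.Link → ℝ≥0 → Ω → ℝ}

lemma coopInfo_comm (k j : Fin Na) : N.coopInfo Pr B k j = N.coopInfo Pr B j k := by
  rw [coopInfo, coopInfo, rdm_angle_comm, add_comm]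

lemma rii_self (k : Fin Na) : N.rii Pr B k (Sum.inl k) = 0 := dif_neg (N.no_self k)

/-- Since `rii` vanishes off the links, the sum extends to all ordered pairs. A pair with an anchor
has one sign factor and only meets a diagonal block; a pair of agents meets two diagonal and two
off-diagonal blocks. -/
lemma sum_links_eq_coopMatrix (a b : Fin Na × Fin 2) :
    ∑ w, N.distGrad w a * N.distGrad w b * N.linkRII Pr B w = N.coopMatrix Pr B a b := by
  obtain ⟨m, r⟩ := a
  obtain ⟨m', r'⟩ := b
  set f : Fin Na × (Fin Na ⊕ Fin Nb) → ℝ := fun p =>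
    linkSign p m * linkSign p m' * (N.rii Pr B p.1 p.2 * rdm (N.angle p.1 p.2) r r') with hf
  have h1 : ∑ w, N.distGrad w (m, r) * N.distGrad w (m', r') * N.linkRII Pr B w =
      ∑ p, f p := by
    have h0 : ∑ p ∈ N.links, f p = ∑ p, f p :=
      Finset.sum_subset (Finset.subset_univ N.links) fun p _ hp => by simp [hf, rii, hp]
    rw [← h0, ← Finset.sum_coe_sort N.links f]
    refine Finset.sum_congr rfl fun w _ => ?_
    simp only [hf, distGrad, rdm_apply, rii, Prod.mk.eta, w.2, dif_pos]
    ring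
  rw [h1, Fintype.sum_prod_type]
  simp only [Fintype.sum_sum_type, Finset.sum_add_distrib]
  have hR : ∀ k j, rdm (N.angle k (Sum.inl j)) r r' = rdm (N.angle j (Sum.inl k)) r r' :=
    fun k j => by rw [rdm_angle_comm]
  have h2 : ∑ k, ∑ l, f (k, Sum.inr l) =
      if m = m' then N.anchorInfo Pr B m r r' else 0 := by
    rw [Finset.sum_eq_single m]
    · by_cases h : m = m'
      · subst h
        simp [hf, linkSign, anchorInfo, Matrix.sum_apply]
      · simp [hf, linkSign, h, Ne.symm h]
    · intro k _ hk
      simp [hf, linkSign, hk.symm]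
    · simp
  set g : Fin Na → Fin Na → ℝ := fun k l =>
    N.rii Pr B k (Sum.inl l) * rdm (N.angle k (Sum.inl l)) r r' with hg
  have h3 : ∑ k, ∑ l, f (k, Sum.inl l) =
      ((if m = m' then ∑ l, g m l else 0) + (if m = m' then ∑ k, g k m else 0)) -
        (g m m' + g m' m) := by
    -- Expansion of `(δ_{mk} - δ_{ml}) (δ_{m'k} - δ_{m'l})`.
    have e : ∀ k l, f (k, Sum.inl l) =
        (if m = k then (if m' = k then g k l else 0) else 0) +
        (if m = l then (if m' = l then g k l else 0) else 0) -
        ((if m = k then (if m' = l then g k l else 0) else 0) +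
        (if m = l then (if m' = k then g k l else 0) else 0)) := by
      intro k l
      simp only [hf, linkSign, hg, Sum.inl.injEq]
      split_ifs <;> ring
    simp only [e, Finset.sum_sub_distrib, Finset.sum_add_distrib]
    congr 2
    · rw [Finset.sum_eq_single m]
      · simp [eq_comm]
      · intro k _ hk; simp [hk.symm]
      · simp
    · rw [Finset.sum_comm, Finset.sum_eq_single m]
      · simp [eq_comm]
      · intro k _ hk; simp [hk.symm]
      · simp
    · simp
    · rw [Finset.sum_comm]; simp
  rw [h2, h3, coopMatrix, Matrix.of_apply]
  simp only
  by_cases h : m = m'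
  · subst h
    -- No agent hears itself, so the index `m` can be erased from both sums at no cost.
    have hgm : g m m = 0 := by simp [hg, rii_self]
    simp only [if_true, hgm, Matrix.add_apply, Matrix.sum_apply]
    rw [← Finset.add_sum_erase _ (fun l => g m l) (Finset.mem_univ m),
      ← Finset.add_sum_erase _ (fun k => g k m) (Finset.mem_univ m), hgm]
    have : ∑ j ∈ Finset.univ.erase m, N.coopInfo Pr B m j r r' =
        ∑ j ∈ Finset.univ.erase m, g m j + ∑ j ∈ Finset.univ.erase m, g j m := by
      rw [← Finset.sum_add_distrib]
      refine Finset.sum_congr rfl fun j _ => ?_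
      simp only [coopInfo, hg, Matrix.smul_apply, smul_eq_mul, hR j m]
      ring
    rw [this]
    ring
  · simp only [h, if_false, Matrix.neg_apply, coopInfo, hg, Matrix.smul_apply, smul_eq_mul,
      hR m' m]
    ring

end Observation

end Network

/-! ### Nonnegativity of the ranging intensities. -/

/-- Integration by parts against the constant 1; integrability of `g` and of its derivative excludes
a boundary term. -/
lemma integral_lineDeriv_eq_zero {ι : Type*} [Fintype ι] {g : (ι → ℝ) → ℝ} {v : ι → ℝ}
    (hd : Differentiable ℝ g) (hg : Integrable g)
    (hg' : Integrable fun x => lineDeriv ℝ g x v) : ∫ x, lineDeriv ℝ g x v = 0 := by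
  have h := integral_bilinear_hasLineDerivAt_right_eq_neg_left_of_integrable
    (μ := (volume : Measure (ι → ℝ))) (f := fun _ => (1 : ℝ)) (f' := fun _ => 0) (g := g)
    (g' := fun x => lineDeriv ℝ g x v) (v := v) (B := ContinuousLinearMap.mul ℝ ℝ)
    (by simp) (by simpa using hg') (by simpa using hg)
    (fun x _ => by
      have := (hasFDerivAt_const (𝕜 := ℝ) (1 : ℝ) x).hasLineDerivAt v
      simpa using this)
    (fun x _ => (hd x).lineDifferentiableAt.hasLineDerivAt)
  simpa using h

lemma secondPartial_log {E : Type*} [NormedAddCommGroup E] [NormedSpace ℝ E] {f : E → ℝ} {x : E}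
    (hf : ContDiffAt ℝ 2 f x) (h0 : f x ≠ 0) (u v : E) :
    secondPartial (fun y => Real.log (f y)) x u v =
      secondPartial f x u v / f x - fderiv ℝ f x u * fderiv ℝ f x v / f x ^ 2 := by
  have hl : ContDiffAt ℝ 2 Real.log (f x) := Real.contDiffAt_log.2 h0
  have h1 : ∀ a b : ℝ, secondPartial Real.log (f x) a b = -(a * b / f x ^ 2) := by
    intro a b
    have hev : (fun y => lineDeriv ℝ Real.log y b) =ᶠ[𝓝 (f x)] fun y => b * y⁻¹ := by
      filter_upwards [eventually_ne_nhds h0] with y hy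
      rw [(Real.differentiableAt_log hy).lineDeriv_eq_fderiv,
        (Real.hasDerivAt_log hy).hasFDerivAt.fderiv]
      simp
    rw [secondPartial, hev.lineDeriv_eq,
      (((hasDerivAt_inv h0).const_mul b).hasFDerivAt.hasLineDerivAt a).lineDeriv]
    simp only [ContinuousLinearMap.toSpanSingleton_apply, smul_eq_mul]
    field_simp
  rw [secondPartial_comp hl hf, h1, secondPartial_eq_fderiv hf,
    (Real.hasDerivAt_log h0).hasFDerivAt.fderiv]
  simp only [ContinuousLinearMap.toSpanSingleton_apply, smul_eq_mul]
  ring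

lemma hasDerivAt_fderiv_fst {ι : Type*} [Fintype ι] {f : ℝ × (ι → ℝ) → ℝ} {x : ℝ} {κ : ι → ℝ}
    (h : ContDiffAt ℝ 2 f (x, κ)) :
    HasDerivAt (fun x => fderiv ℝ f (x, κ) (1, 0))
      (fderiv ℝ (fderiv ℝ f) (x, κ) (1, 0) (1, 0)) x := by
  have h1 : DifferentiableAt ℝ (fderiv ℝ f) (x, κ) :=
    (h.fderiv_right (m := 1) (by norm_num)).differentiableAt one_ne_zero
  have h2 : HasDerivAt (fun x : ℝ => (x, κ)) ((1 : ℝ), (0 : ι → ℝ)) x :=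
    (hasDerivAt_id x).prodMk (hasDerivAt_const x κ)
  have h3 := h1.hasFDerivAt.clm_apply
    (hasFDerivAt_const (𝕜 := ℝ) ((1 : ℝ), (0 : ι → ℝ)) (x, κ))
  refine (h3.comp_hasDerivAt x h2).congr_deriv ?_
  simp

namespace Network

variable {Na Nb : ℕ} (N : Network Na Nb)

lemma PriorSmooth.contDiffAt {N : Network Na Nb} {w : N.Link} (h : N.PriorSmooth w) {x : ℝ}
    (hx : 0 < x) (κ : {i // i ∈ N.random w} → ℝ) :
    ContDiffAt ℝ 2 (Function.uncurry (N.prior w)) (x, κ) :=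
  h.contDiffOn.contDiffAt (prod_mem_nhds (Ioi_mem_nhds hx) univ_mem)

/-- The second derivative of the prior in the distance has integral zero. -/
lemma integral_secondPartial_dist (w : N.Link) (hr : N.PriorRegular w) (hs : N.PriorSmooth w) :
    ∫ κ : {i // i ∈ N.random w} → ℝ, secondPartial (Function.uncurry (N.prior w))
      (N.trueDist w, κ) (pairDir none) (pairDir none) = 0 := by
  obtain ⟨ε₁, hε₁, b₁, hb₁, hlip⟩ := hr.lipschitz
  obtain ⟨ε₂, hε₂, b₂, hb₂, hdom⟩ := hs.dominated
  have hd0 := N.trueDist_pos w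
  set d := N.trueDist w
  set F' : ℝ → ({i // i ∈ N.random w} → ℝ) → ℝ := fun x κ =>
    fderiv ℝ (Function.uncurry (N.prior w)) (x, κ) (1, 0) with hF'
  set F'' : ℝ → ({i // i ∈ N.random w} → ℝ) → ℝ := fun x κ =>
    fderiv ℝ (fderiv ℝ (Function.uncurry (N.prior w))) (x, κ) (1, 0) (1, 0) with hF''
  -- Within `δ` of the true distance, distances stay positive and both the Lipschitz and the
  -- domination bounds apply.
  set δ := min d (min ε₁ ε₂) with hδ
  have hδ0 : 0 < δ := lt_min hd0 (lt_min hε₁ hε₂)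
  have hpos : ∀ x ∈ Metric.ball d δ, 0 < x := by
    intro x hx
    rw [Metric.mem_ball, Real.dist_eq, abs_lt] at hx
    have : δ ≤ d := min_le_left _ _
    linarith [hx.1]
  have hD1 : ∀ x, 0 < x → ∀ κ, HasDerivAt (fun x => N.prior w x κ) (F' x κ) x := fun x hx κ =>
    hasDerivAt_fst ((hs.contDiffAt hx κ).differentiableAt two_ne_zero)
  have hD2 : ∀ x, 0 < x → ∀ κ, HasDerivAt (fun x => F' x κ) (F'' x κ) x := fun x hx κ =>
    hasDerivAt_fderiv_fst (hs.contDiffAt hx κ)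
  -- The first derivative has integral zero at every nearby distance, not only at `d`, so this
  -- integral can be differentiated once more.
  have hint : ∀ x ∈ Metric.ball d δ, Integrable (F' x) ∧ ∫ κ, F' x κ = 0 := by
    intro x hx
    obtain ⟨ε, hε, hsub⟩ := Metric.isOpen_iff.1 Metric.isOpen_ball x hx
    refine N.integral_deriv_prior w hε hb₁ (hpos x hx) ?_
      (ae_of_all _ fun κ => hD1 x (hpos x hx) κ)
    filter_upwards [hlip] with κ hκ
    exact hκ.mono (hsub.trans (Metric.ball_subset_ball ((min_le_right _ _).trans
      (min_le_left _ _))))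
  have hiter : ∀ x, 0 < x → ∀ κ, iteratedDeriv 2 (fun x => N.prior w x κ) x = F'' x κ := by
    intro x hx κ
    have he : deriv (fun x => N.prior w x κ) =ᶠ[𝓝 x] fun x => F' x κ := by
      filter_upwards [eventually_gt_nhds hx] with y hy using (hD1 y hy κ).deriv
    rw [iteratedDeriv_succ, iteratedDeriv_one, he.deriv_eq, (hD2 x hx κ).deriv]
  have hF''_eq : ∀ κ, secondPartial (Function.uncurry (N.prior w)) (d, κ) (pairDir none)
      (pairDir none) = F'' d κ := fun κ => secondPartial_eq_fderiv (hs.contDiffAt hd0 κ) _ _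
  have hball : Metric.ball d δ ∈ 𝓝 d := Metric.ball_mem_nhds d hδ0
  have hmeas : AEStronglyMeasurable (F'' d) volume :=
    (hs.second none none).aestronglyMeasurable.congr (ae_of_all _ hF''_eq)
  have key := hasDerivAt_integral_of_dominated_loc_of_deriv_le (F := F') (F' := F'') (bound := b₂)
    hball (by filter_upwards [hball] with x hx using (hint x hx).1.aestronglyMeasurable)
    (hint d (Metric.mem_ball_self hδ0)).1 hmeas
    (by filter_upwards [hdom] with κ hκ x hx
        rw [Real.norm_eq_abs, ← hiter x (hpos x hx) κ]
        exact hκ x (Metric.ball_subset_ball ((min_le_right _ _).trans (min_le_right _ _)) hx))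
    hb₂ (ae_of_all _ fun κ x hx => hD2 x (hpos x hx) κ)
  have hc : (fun x => ∫ κ, F' x κ) =ᶠ[𝓝 d] fun _ => 0 := by
    filter_upwards [hball] with x hx using (hint x hx).2
  simp_rw [hF''_eq]
  exact key.2.unique ((hasDerivAt_const d (0 : ℝ)).congr_of_eventuallyEq hc)

lemma lineDeriv_slice {ι : Type*} (f : ℝ × (ι → ℝ) → ℝ) (x : ℝ) (κ v : ι → ℝ) :
    lineDeriv ℝ (fun κ => f (x, κ)) κ v = lineDeriv ℝ f (x, κ) (0, v) := by
  simp [lineDeriv]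

/-- The mixed second derivatives of the prior have integral zero. -/
lemma integral_secondPartial_chan (w : N.Link) (hs : N.PriorSmooth w)
    (i : {i // i ∈ N.random w}) (o : Option {i // i ∈ N.random w}) :
    ∫ κ : {i // i ∈ N.random w} → ℝ, secondPartial (Function.uncurry (N.prior w))
      (N.trueDist w, κ) (pairDir (some i)) (pairDir o) = 0 := by
  have h2 := hs.second (some i) o
  set g : ({i // i ∈ N.random w} → ℝ) → ℝ := fun κ =>
    lineDeriv ℝ (Function.uncurry (N.prior w)) (N.trueDist w, κ) (pairDir o) with hg
  -- The outer derivative runs along a random component, hence is a line derivative in `κ` at fixed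
  -- distance and integrates to zero.
  have he : ∀ κ, secondPartial (Function.uncurry (N.prior w))
      (N.trueDist w, κ) (pairDir (some i)) (pairDir o) = lineDeriv ℝ g κ (Pi.single i 1) := by
    intro κ
    exact (lineDeriv_slice (fun y => lineDeriv ℝ (Function.uncurry (N.prior w)) y (pairDir o))
      _ κ _).symm
  simp_rw [he] at h2 ⊢
  refine integral_lineDeriv_eq_zero (fun κ => ?_) (hs.first o) h2
  have h3 := (ContDiffAt.lineDeriv_right (n := 1) (hs.contDiffAt (N.trueDist_pos w) κ)
    (pairDir o)).differentiableAt one_ne_zero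
  exact h3.comp (f := fun κ => (N.trueDist w, κ)) κ
    ((differentiableAt_const _).prodMk differentiableAt_id)

lemma integral_secondPartial_prior (w : N.Link) (hr : N.PriorRegular w) (hs : N.PriorSmooth w)
    (e : ℝ × ({i // i ∈ N.random w} → ℝ)) :
    Integrable (fun κ : {i // i ∈ N.random w} → ℝ =>
      secondPartial (Function.uncurry (N.prior w)) (N.trueDist w, κ) e e) ∧
    ∫ κ : {i // i ∈ N.random w} → ℝ,
      secondPartial (Function.uncurry (N.prior w)) (N.trueDist w, κ) e e = 0 := by
  have he : ∀ κ, secondPartial (Function.uncurry (N.prior w)) (N.trueDist w, κ) e e =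
      ∑ i, ∑ j, pairCoeff e i * pairCoeff e j * secondPartial (Function.uncurry (N.prior w))
        (N.trueDist w, κ) (pairDir i) (pairDir j) := by
    intro κ
    conv_lhs => rw [pair_eq_sum_pairDir e]
    exact secondPartial_sum_sum (hs.contDiffAt (N.trueDist_pos w) κ) _ (pairCoeff e) (pairCoeff e)
  have h0 : ∀ i j, ∫ κ : {i // i ∈ N.random w} → ℝ, secondPartial (Function.uncurry (N.prior w))
      (N.trueDist w, κ) (pairDir i) (pairDir j) = 0 := by
    intro i j
    rcases i with _ | i
    · rcases j with _ | j
      · exact N.integral_secondPartial_dist w hr hs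
      -- Symmetry moves the channel direction to the outside, where integration by parts applies.
      · simp_rw [fun κ => secondPartial_comm (hs.contDiffAt (N.trueDist_pos w) κ)
          (pairDir none) (pairDir (some j))]
        exact N.integral_secondPartial_chan w hs j none
    · exact N.integral_secondPartial_chan w hs i j
  have hi : ∀ i j, Integrable fun κ : {i // i ∈ N.random w} → ℝ =>
      pairCoeff e i * pairCoeff e j * secondPartial (Function.uncurry (N.prior w))
        (N.trueDist w, κ) (pairDir i) (pairDir j) := fun i j => (hs.second i j).const_mul _
  simp_rw [he]
  refine ⟨integrable_finsetSum _ fun i _ => integrable_finsetSum _ fun j _ => hi i j, ?_⟩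
  rw [integral_finsetSum _ fun i _ => integrable_finsetSum _ fun j _ => hi i j]
  refine Finset.sum_eq_zero fun i _ => ?_
  rw [integral_finsetSum _ fun j _ => hi i j]
  refine Finset.sum_eq_zero fun j _ => ?_
  rw [integral_const_mul, h0, mul_zero]

section Observation

variable {Ω : Type*} [MeasurableSpace Ω] {Pr : Measure Ω}
  {B : N.Link → ℝ≥0 → Ω → ℝ}

/-- Pointwise, `f · (-D² log f)` is at least `-D² f`, and the latter has integral zero. -/
lemma Xi_nonneg (hprior : ∀ w, N.PriorRegular w) (hinfo : N.FiniteInfo Pr B) (w : N.Link)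
    (hs : N.PriorSmooth w) (a : ℝ × (Chan (N.paths w) → ℝ)) :
    0 ≤ pairCoeff a ⬝ᵥ (N.Xi w *ᵥ pairCoeff a) := by
  have h := N.integral_logPrior_bilin hprior hinfo w a a
  have hz := N.integral_secondPartial_prior w (hprior w) hs (N.pairRandomPart w a)
  rw [← h.2, integral_chanLaw]
  calc (0 : ℝ) = ∫ κ, -secondPartial (Function.uncurry (N.prior w)) (N.trueDist w, κ)
        (N.pairRandomPart w a) (N.pairRandomPart w a) := by rw [integral_neg, hz.2, neg_zero]
    _ ≤ _ := by
      refine integral_mono hz.1.neg ((N.integrable_chanLaw_iff w _).1 h.1.neg) fun κ => ?_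
      have hc := hs.contDiffAt (N.trueDist_pos w) κ
      have e := N.pairRandomPart_chanOf w (N.trueDist w) κ
      rcases (N.prior_nonneg w _ (N.trueDist_pos w) κ).eq_or_lt with h0 | h0
      -- At a zero of the density the weighted integrand is zero, and `-D² f ≤ 0` because the point
      -- minimizes a nonnegative function.
      · have hn := secondPartial_nonneg_of_eq_zero hc h0.symm
          (by filter_upwards [prod_mem_nhds (Ioi_mem_nhds (N.trueDist_pos w)) univ_mem] with y hy
              exact N.prior_nonneg w y.1 hy.1 y.2) (N.pairRandomPart w a)
        simp only [← h0, zero_mul]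
        linarith
      · have hne : Function.uncurry (N.prior w) (N.trueDist w, κ) ≠ 0 := h0.ne'
        have h1 : secondPartial (N.logPrior w) (N.trueDist w, N.chanOf w κ) a a =
            secondPartial (fun y => Real.log (Function.uncurry (N.prior w) y))
              (N.trueDist w, κ) (N.pairRandomPart w a) (N.pairRandomPart w a) := by
          have := secondPartial_comp_clm (N.pairRandomPart w) (x := (N.trueDist w, N.chanOf w κ))
            (g := fun y => Real.log (Function.uncurry (N.prior w) y))
            (by rw [e]; exact hc.log hne) a a
          rw [e] at this
          exact this
        simp only [h1, secondPartial_log hc hne]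
        have hu : Function.uncurry (N.prior w) (N.trueDist w, κ) = N.prior w (N.trueDist w) κ := rfl
        rw [hu]
        set p := N.prior w (N.trueDist w) κ
        set D := fderiv ℝ (Function.uncurry (N.prior w)) (N.trueDist w, κ) (N.pairRandomPart w a)
        set S := secondPartial (Function.uncurry (N.prior w)) (N.trueDist w, κ)
          (N.pairRandomPart w a) (N.pairRandomPart w a)
        have h2 : p * -(S / p - D * D / p ^ 2) = -S + D * D / p := by field_simp; ring
        rw [h2]
        have : 0 ≤ D * D / p := div_nonneg (mul_self_nonneg _) h0.le
        linarith

variable [IsProbabilityMeasure Pr]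

lemma linkInfo_nonneg (hB : N.IsNoise Pr B) (hsig : ContDiff ℝ 3 N.s)
    (hprior : ∀ w, N.PriorRegular w) (hinfo : N.FiniteInfo Pr B) (w : N.Link)
    (hs : N.PriorSmooth w) (a : ℝ × (Chan (N.paths w) → ℝ)) :
    0 ≤ N.linkInfo Pr B w a a :=
  add_nonneg (N.Psi_nonneg hB hsig hinfo w _) (N.Xi_nonneg hprior hinfo w hs a)

omit [IsProbabilityMeasure Pr] in
lemma linkInfo_comm (hB : N.IsNoise Pr B) (hsig : ContDiff ℝ 3 N.s)
    (hprior : ∀ w, N.PriorRegular w) (w : N.Link) (a b : ℝ × (Chan (N.paths w) → ℝ)) :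
    N.linkInfo Pr B w a b = N.linkInfo Pr B w b a := by
  rw [linkInfo, linkInfo, Matrix.dotProduct_mulVec, ← Matrix.mulVec_transpose,
    N.Psi_symm hB hsig w, dotProduct_comm, Matrix.dotProduct_mulVec (pairCoeff a),
    ← Matrix.mulVec_transpose, N.Xi_symm hprior w, dotProduct_comm (N.Xi w *ᵥ _)]

omit [IsProbabilityMeasure Pr] in
/-- The ranging information intensity is the information about the distance, minimized over
the directions of the channel. -/
lemma linkRII_eq_linkInfo (hB : N.IsNoise Pr B) (hsig : ContDiff ℝ 3 N.s)
    (hprior : ∀ w, N.PriorRegular w) (w : N.Link) (hu : IsUnit (N.chanInfo Pr B w).det) :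
    N.linkRII Pr B w =
      N.linkInfo Pr B w (1, -((N.chanInfo Pr B w)⁻¹ *ᵥ N.crossInfo Pr B w))
        (1, -((N.chanInfo Pr B w)⁻¹ *ᵥ N.crossInfo Pr B w)) := by
  set x := (N.chanInfo Pr B w)⁻¹ *ᵥ N.crossInfo Pr B w with hx
  have hsplit : ((1, -x) : ℝ × (Chan (N.paths w) → ℝ)) = (1, 0) + (0, -x) := by simp
  -- With this choice the two cross terms give `-2` and the channel term `+1` times the Schur
  -- correction, which is thus subtracted once.
  have hcx : N.chanInfo Pr B w *ᵥ (-x) = -N.crossInfo Pr B w := by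
    rw [Matrix.mulVec_neg, hx, Matrix.mulVec_mulVec, Matrix.mul_nonsing_inv _ hu,
      Matrix.one_mulVec]
  rw [hsplit, linkInfo_add_left, linkInfo_add_right, linkInfo_add_right,
    N.linkInfo_comm hB hsig hprior w (0, -x) (1, 0), linkInfo_dist_dist, linkInfo_dist_chan,
    linkInfo_chan_chan, hcx, linkRII, ← hx]
  simp only [dotProduct_neg, neg_dotProduct, dotProduct_comm x]
  ring

lemma rii_nonneg (hB : N.IsNoise Pr B) (hsig : ContDiff ℝ 3 N.s)
    (hprior : ∀ w, N.PriorRegular w) (hinfo : N.FiniteInfo Pr B)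
    (hC : IsUnit ((N.fim Pr B).toBlocks₂₂).det) (hs : ∀ w, N.PriorSmooth w)
    (k : Fin Na) (j : Fin Na ⊕ Fin Nb) : 0 ≤ N.rii Pr B k j := by
  rw [rii]
  split_ifs with h
  · rw [N.linkRII_eq_linkInfo hB hsig hprior _
      (N.isUnit_det_chanInfo hB hsig hprior hinfo hC _)]
    exact N.linkInfo_nonneg hB hsig hprior hinfo _ (hs _) _
  · exact le_rfl

end Observation

end Network

end CoopLoc

theorem theorem1 {Na Nb : ℕ} (N : CoopLoc.Network Na Nb)
    {Ω : Type*} [MeasurableSpace Ω] (Pr : MeasureTheory.Measure Ω)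
    [MeasureTheory.IsProbabilityMeasure Pr]
    (B : N.Link → NNReal → Ω → ℝ) (hB : N.IsNoise Pr B)
    (hs : ContDiff ℝ 3 N.s)
    (hprior : ∀ w, N.PriorRegular w)
    (hinfo : N.FiniteInfo Pr B)
    (hC : IsUnit ((N.fim Pr B).toBlocks₂₂).det) :
    N.efim Pr B = N.coopMatrix Pr B ∧
    (∀ k j, k ≠ j → N.coopInfo Pr B k j = N.coopInfo Pr B j k) ∧
    ((∀ w, N.PriorSmooth w) → ∀ k j, 0 ≤ N.rii Pr B k j) := by
  refine ⟨?_, fun k j _ => N.coopInfo_comm k j, N.rii_nonneg hB hs hprior hinfo hC⟩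
  ext a b
  rw [N.efim_apply hB hs hprior hinfo hC, N.sum_links_eq_coopMatrix]
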